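/- For integers $n,k\ge 0$ with $k\le n/3$ define the following (classes of) graphs on $n$ vertices. - $E_1(n,k)$: the vertex set is a disjoint union $X\cup Y_1\cup Y_2$ with $|X|=k$, $|Y_1|=\lceil\frac{n-k}2\rceil$, $|Y_2|=\lfloor\frac{n-k}2\rfloor$; the edges are all pairs meeting $X$ and all pairs between $Y_1$ and $Y_2$. - $E_2(n,k)$, defined only for $k<\frac{n-1}4$: the vertex set is a disjoint union $X\cup Y_1\cup Y_2$ with $|X|=2k+1$ and either $|Y_1|=\lfloor\frac n2\rfloor$, $|Y_2|=\lceil\frac n2\rceil-2k-1$, or $|Y_1|=\lceil\frac n2\rceil$, $|Y_2|=\lfloor\frac n2\rfloor-2k-1$; the edges are all pairs inside $X$ and all pairs between $Y_1$ and $X\cup Y_2$. - $E_3(n,k)$: the vertex set is a disjoint union $X\cup Y_1$ with $|X|=2k+1$, $|Y_1|=n-2k-1$; the edges are all pairs meeting $X$. - $E_4(n,k)$, defined only for $6k-n+4\ge 0$: if $k\ge\frac{n-2}3$ it is the complete graph $K_n$; otherwise the vertex set is a disjoint union $X\cup Y_1\cup Y_2\cup Y_3\cup Y_4$ with $|Y_1|=|Y_3|$,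 $|Y_2|=|Y_4|$, $|Y_1|+|Y_2|=n-3k-2$, $|X|=6k-n+4$; the edges are all pairs inside $X$, all pairs between $X$ and $Y_1\cup Y_2$, and all pairs between $Y_1\cup Y_4$ and $Y_2\cup Y_3$. Where $E_j(n,k)$ is a class of several graphs, all of them have the same number of edges; write $e(E_j(n,k))$ for this number, and $e(G)$ for the number of edges of a graph $G$. Theorem. There is an absolute constant $n_0$ such that for every $n>n_0$ and every integer $k$ with $0\le k\le n/3$ the following holds. If $G$ is a graph on $n$ vertices that does not contain $k+1$ vertex-disjoint triangles, then $$e(G)\le\max_{j\in\{1,2,3,4\}} e\big(E_j(n,k)\big),$$ where the maximum is over those $j$ for which $E_j(n,k)$ is defined. -/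

import Mathlib

namespace DensityCH

/-- `G` contains `l` vertex-disjoint (not necessarily induced) triangles. -/
def HasDisjointTriangles {V : Type*} (G : SimpleGraph V) (l : ℕ) : Prop :=
  ∃ T : Fin l → Finset V,
    (∀ i, G.IsNClique 3 (T i)) ∧ ∀ i j, i ≠ j → Disjoint (T i) (T j)

/-- The number of edges `e(G)` (used for graphs on finite vertex sets only). -/
noncomputable def numEdges {V : Type*} (G : SimpleGraph V) : ℕ :=
  G.edgeSet.ncard

/-- The (possibly empty) sets in the list `L` partition the vertex set. -/
def Partitions {n : ℕ} (L : List (Finset (Fin n))) : Prop :=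
  L.Pairwise Disjoint ∧ ∀ v, ∃ A ∈ L, v ∈ A

/-- The pair `u, v` goes between `A` and `B`. -/
def Between {n : ℕ} (A B : Finset (Fin n)) (u v : Fin n) : Prop :=
  (u ∈ A ∧ v ∈ B) ∨ (u ∈ B ∧ v ∈ A)

/-- `H` is a graph `E₁(n,k)`: `|X| = k`, `|Y₁| = ⌈(n-k)/2⌉`, `|Y₂| = ⌊(n-k)/2⌋`; all edges
meeting `X` and all edges between `Y₁` and `Y₂`. -/
def IsE₁ (n k : ℕ) (H : SimpleGraph (Fin n)) : Prop :=
  ∃ X Y₁ Y₂ : Finset (Fin n), Partitions [X, Y₁, Y₂] ∧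
    X.card = k ∧ Y₁.card = (n - k + 1) / 2 ∧ Y₂.card = (n - k) / 2 ∧
    ∀ u v, H.Adj u v ↔ u ≠ v ∧ (u ∈ X ∨ v ∈ X ∨ Between Y₁ Y₂ u v)

/-- `H` is one of the graphs `E₂(n,k)`, defined for `k < (n-1)/4` only: `|X| = 2k+1` and
`|Y₁| = ⌊n/2⌋`, `|Y₂| = ⌈n/2⌉-2k-1`, or `|Y₁| = ⌈n/2⌉`, `|Y₂| = ⌊n/2⌋-2k-1`; all edges inside `X`
and all edges between `Y₁` and `X ∪ Y₂`. -/
def IsE₂ (n k : ℕ) (H : SimpleGraph (Fin n)) : Prop :=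
  4 * k + 1 < n ∧
  ∃ X Y₁ Y₂ : Finset (Fin n), Partitions [X, Y₁, Y₂] ∧
    X.card = 2 * k + 1 ∧
    ((Y₁.card = n / 2 ∧ Y₂.card + (2 * k + 1) = (n + 1) / 2) ∨
      (Y₁.card = (n + 1) / 2 ∧ Y₂.card + (2 * k + 1) = n / 2)) ∧
    ∀ u v, H.Adj u v ↔ u ≠ v ∧ ((u ∈ X ∧ v ∈ X) ∨ Between Y₁ (X ∪ Y₂) u v)

/-- `H` is a graph `E₃(n,k)`: `|X| = 2k+1`, `|Y₁| = n-2k-1`; all edges meeting `X`. -/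
def IsE₃ (n k : ℕ) (H : SimpleGraph (Fin n)) : Prop :=
  ∃ X Y₁ : Finset (Fin n), Partitions [X, Y₁] ∧
    X.card = 2 * k + 1 ∧ Y₁.card + (2 * k + 1) = n ∧
    ∀ u v, H.Adj u v ↔ u ≠ v ∧ (u ∈ X ∨ v ∈ X)

/-- `H` is one of the graphs `E₄(n,k)`, defined for `k ≥ n/6 - 2` only. If `k ≥ (n-2)/3` this is the
complete graph. Otherwise `|Y₁| = |Y₃|`, `|Y₂| = |Y₄|`, `|Y₁| + |Y₂| = n-3k-2`, `|X| = 6k-n+4`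
(so that there is no such graph if `6k-n+4 < 0`); all edges inside `X`, between `X` and `Y₁ ∪ Y₂`,
and between `Y₁ ∪ Y₄` and `Y₂ ∪ Y₃`. -/
def IsE₄ (n k : ℕ) (H : SimpleGraph (Fin n)) : Prop :=
  n ≤ 6 * k + 12 ∧
  ((n ≤ 3 * k + 2 ∧ H = ⊤) ∨
   (3 * k + 2 < n ∧
    ∃ X Y₁ Y₂ Y₃ Y₄ : Finset (Fin n), Partitions [X, Y₁, Y₂, Y₃, Y₄] ∧
      Y₁.card = Y₃.card ∧ Y₂.card = Y₄.card ∧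
      Y₁.card + Y₂.card + (3 * k + 2) = n ∧ X.card + n = 6 * k + 4 ∧
      ∀ u v, H.Adj u v ↔ u ≠ v ∧
        ((u ∈ X ∧ v ∈ X) ∨ Between X (Y₁ ∪ Y₂) u v ∨ Between (Y₁ ∪ Y₄) (Y₂ ∪ Y₃) u v)))

/-- The four classes of extremal graphs; the index `j : Fin 4` stands for `E_{j+1}(n,k)`. -/
def extremalClass (n k : ℕ) (j : Fin 4) : Set (SimpleGraph (Fin n)) :=
  {H | (![IsE₁ n k, IsE₂ n k, IsE₃ n k, IsE₄ n k] j) H}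

/-- The class with index `j` is nonempty (the construction is defined for `n`, `k`), and `m` is the
common number of edges of its members. -/
def IsExtremalEdgeNumber (n k : ℕ) (j : Fin 4) (m : ℕ) : Prop :=
  (extremalClass n k j).Nonempty ∧ ∀ H ∈ extremalClass n k j, numEdges H = m

end DensityCH

/-! The bound holds for all `n`, by induction on `n`. In a counterexample for `(n, k)`, deleting a
vertex leaves a graph for `(n - 1, k)` and deleting a triangle leaves a graph for `(n - 3, k - 1)`,
so the inductive bounds force lower bounds on every degree and on the degree sum of every triangle.

If `n ≥ 4 * k + 3`, the bound for `k - 1` gives `k` disjoint triangles. Among all such tilings take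
one with a largest matching on the uncovered vertices. If there were no `k + 1` disjoint triangles,
then exchanging triangles would limit the number of edges between each triangle of the tiling and
the edges of the matching or the unmatched vertices, contradicting the lower bounds on degrees.

If `n` is smaller, consider the vertices that lie in no triangle. If they are few, the
Corrádi–Hajnal theorem finds `k + 1` disjoint triangles among suitable `3 * (k + 1)` of the other
vertices. If they are many, they cost so many edges that there are no more than in `E₃` or `E₄`.
-/

namespace DensityCH

open Finset

open Classical in
/-- The number of neighbours of `v` in `A`. The vertex `v` may lie in `A`, where it does not
count. -/
noncomputable def degIn {V : Type*} (G : SimpleGraph V) (A : Finset V) (v : V) : ℕ :=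
  #{w ∈ A | G.Adj v w}

/-- The sum of the degrees of the graph induced on `A`, that is, twice its number of edges. Working
with the double avoids divisions and needs no induced subgraphs. -/
noncomputable def degSum {V : Type*} (G : SimpleGraph V) (A : Finset V) : ℕ :=
  ∑ v ∈ A, degIn G A v

/-- A family of pairwise disjoint `r`-cliques, which need not cover all vertices. For `r = 2` this
is a matching. -/
structure IsTiling {V : Type*} (G : SimpleGraph V) (r : ℕ) (𝒯 : Finset (Finset V)) : Prop where
  isNClique : ∀ t ∈ 𝒯, G.IsNClique r t
  pairwiseDisjoint : (𝒯 : Set (Finset V)).PairwiseDisjoint id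

section Degrees

variable {V : Type*} {G H : SimpleGraph V} {A B : Finset V} {u v w : V}

lemma degIn_le_card (A : Finset V) (v : V) : degIn G A v ≤ #A := by
  classical exact card_filter_le _ _

lemma degIn_mono (h : A ⊆ B) (v : V) : degIn G A v ≤ degIn G B v := by
  classical exact card_le_card (filter_subset_filter _ h)

lemma degIn_mono_left (h : G ≤ H) (A : Finset V) (v : V) : degIn G A v ≤ degIn H A v := by
  classical exact card_le_card (monotone_filter_right _ fun _ _ hw => h hw)

lemma degIn_union [DecidableEq V] (h : Disjoint A B) (v : V) :
    degIn G (A ∪ B) v = degIn G A v + degIn G B v := by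
  classical
  rw [degIn, filter_union, card_union_of_disjoint (disjoint_filter_filter h), degIn, degIn]

lemma degIn_add_degIn_sdiff [DecidableEq V] (h : A ⊆ B) (v : V) :
    degIn G A v + degIn G (B \ A) v = degIn G B v := by
  rw [← degIn_union disjoint_sdiff, union_sdiff_of_subset h]

lemma degIn_biUnion [DecidableEq V] {ι : Type*} {s : Finset ι} {f : ι → Finset V}
    (h : (s : Set ι).PairwiseDisjoint f) (v : V) :
    degIn G (s.biUnion f) v = ∑ i ∈ s, degIn G (f i) v := by
  classical
  simp only [degIn, filter_biUnion]
  exact card_biUnion fun i hi j hj hij => disjoint_filter_filter (h hi hj hij)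

lemma degIn_eq_card_iff : degIn G A v = #A ↔ ∀ w ∈ A, G.Adj v w := by
  classical exact card_filter_eq_iff

lemma degIn_eq_zero_iff : degIn G A v = 0 ↔ ∀ w ∈ A, ¬ G.Adj v w := by
  classical rw [degIn, card_eq_zero, filter_eq_empty_iff]

lemma sum_degIn_comm (A B : Finset V) : ∑ v ∈ A, degIn G B v = ∑ w ∈ B, degIn G A w := by
  classical
  simp only [degIn, card_filter]
  rw [sum_comm]
  exact sum_congr rfl fun w _ => sum_congr rfl fun v _ => if_congr (G.adj_comm v w) rfl rfl

lemma degIn_add_degIn_le (h : ∀ w ∈ A, G.Adj u w → ¬ G.Adj v w) :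
    degIn G A u + degIn G A v ≤ #A := by
  classical
  have hd : Disjoint {w ∈ A | G.Adj u w} {w ∈ A | G.Adj v w} := disjoint_filter.2 h
  rw [degIn, degIn, ← card_union_of_disjoint hd]
  exact card_le_card (union_subset (filter_subset _ _) (filter_subset _ _))

lemma exists_common_neighbor (h : #A < degIn G A u + degIn G A v) :
    ∃ w ∈ A, G.Adj u w ∧ G.Adj v w := by
  by_contra! hc
  exact h.not_ge (degIn_add_degIn_le hc)

lemma degIn_add_card_le (hBA : B ⊆ A) (h : ∀ w ∈ B, ¬ G.Adj v w) : degIn G A v + #B ≤ #A := by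
  classical
  rw [← degIn_add_degIn_sdiff hBA, degIn_eq_zero_iff.2 h, zero_add,
    ← card_sdiff_add_card_eq_card hBA]
  exact Nat.add_le_add_right (degIn_le_card _ _) _

lemma degIn_erase_of_not_adj [DecidableEq V] (h : ¬ G.Adj v w) :
    degIn G (A.erase w) v = degIn G A v := by
  simp [degIn, filter_erase, h]

lemma degIn_erase_add_one [DecidableEq V] (hw : w ∈ A) (h : G.Adj v w) :
    degIn G (A.erase w) v + 1 = degIn G A v := by
  classical
  rw [degIn, filter_erase]
  exact card_erase_add_one (mem_filter.2 ⟨hw, h⟩)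

lemma degIn_lt_card (h : v ∈ A) : degIn G A v < #A := by
  classical
  rw [← degIn_erase_of_not_adj G.irrefl]
  exact (degIn_le_card _ _).trans_lt (card_erase_lt_of_mem h)

lemma exists_eq_triple_of_two_le_degIn [DecidableEq V] (hA : #A = 3) (h : 2 ≤ degIn G A v) :
    ∃ a b c, A = {a, b, c} ∧ G.Adj v b ∧ G.Adj v c := by
  classical
  obtain ⟨b, hb, c, hc, hbc⟩ := one_lt_card.1 h
  obtain ⟨hbA, hvb⟩ := mem_filter.1 hb
  obtain ⟨hcA, hvc⟩ := mem_filter.1 hc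
  have hcb : c ∈ A.erase b := mem_erase.2 ⟨hbc.symm, hcA⟩
  obtain ⟨a, ha⟩ := card_eq_one.1 (show #((A.erase b).erase c) = 1 by
    rw [card_erase_of_mem hcb, card_erase_of_mem hbA, hA])
  refine ⟨a, b, c, ?_, hvb, hvc⟩
  rw [insert_comm, pair_comm a c, ← ha, insert_erase hcb, insert_erase hbA]

lemma degSum_erase [DecidableEq V] (h : v ∈ A) :
    degSum G A = degSum G (A.erase v) + 2 * degIn G A v := by
  have hv : degIn G A v = ∑ w ∈ A.erase v, degIn G {v} w := by
    rw [sum_degIn_comm, sum_singleton, degIn_erase_of_not_adj G.irrefl]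
  have hsplit : ∀ w, degIn G A w = degIn G (A.erase v) w + degIn G {v} w := fun w => by
    rw [← degIn_add_degIn_sdiff (singleton_subset_iff.2 h), sdiff_singleton_eq_erase, add_comm]
  rw [degSum, degSum, ← add_sum_erase _ _ h, sum_congr rfl fun w _ => hsplit w, sum_add_distrib,
    ← hv]
  ring

lemma degSum_add_two_of_adj [DecidableEq V] (hv : v ∈ A) (hw : w ∈ A) (h : G.Adj v w) :
    degSum G A + 2 = degSum G ((A.erase v).erase w) + 2 * (degIn G A v + degIn G A w) := by
  rw [degSum_erase hv, degSum_erase (mem_erase.2 ⟨h.ne', hw⟩), ← degIn_erase_add_one hv h.symm]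
  ring

lemma degSum_add_card_le (A : Finset V) : degSum G A + #A ≤ #A * #A := by
  simpa only [degSum, sum_add_distrib, sum_const, smul_eq_mul, mul_one] using
    sum_le_card_nsmul A (fun v => degIn G A v + 1) #A fun v hv => degIn_lt_card hv

lemma degSum_univ [Fintype V] : degSum G univ = 2 * numEdges G := by
  classical
  rw [degSum, numEdges, ← SimpleGraph.coe_edgeFinset, Set.ncard_coe_finset,
    ← SimpleGraph.sum_degrees_eq_twice_card_edges]
  refine sum_congr rfl fun v _ => ?_
  rw [degIn, ← SimpleGraph.card_neighborFinset_eq_degree, SimpleGraph.neighborFinset_eq_filter]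

lemma degIn_induce (W : Finset V) (v : (W : Set V)) :
    degIn (G.induce (W : Set V)) univ v = degIn G W v := by
  rw [degIn, degIn, ← card_map (Function.Embedding.subtype (· ∈ (W : Set V)))]
  congr 1
  ext w
  simp [and_comm]

lemma two_mul_numEdges_induce (W : Finset V) :
    2 * numEdges (G.induce (W : Set V)) = degSum G W := by
  rw [← degSum_univ, degSum, degSum, ← sum_coe_sort W]
  exact sum_congr (by ext; simp) fun v _ => degIn_induce W v

end Degrees

section Tilings

variable {V : Type*} {G : SimpleGraph V} {r l : ℕ} {𝒯 𝒮 : Finset (Finset V)} {s t : Finset V}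

lemma isNClique_pair [DecidableEq V] {a b : V} (hab : G.Adj a b) : G.IsNClique 2 {a, b} := by
  rw [SimpleGraph.isNClique_iff, coe_pair, SimpleGraph.isClique_pair]
  exact ⟨fun _ => hab, card_pair hab.ne⟩

lemma isNClique_triple [DecidableEq V] {a b c : V} (hab : G.Adj a b) (hac : G.Adj a c)
    (hbc : G.Adj b c) : G.IsNClique 3 {a, b, c} :=
  SimpleGraph.is3Clique_triple_iff.2 ⟨hab, hac, hbc⟩

lemma isNClique_insert_erase [DecidableEq V] {v w : V} (ht : G.IsNClique r t) (hw : w ∈ t)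
    (hv : ∀ x ∈ t.erase w, G.Adj v x) : G.IsNClique r (insert v (t.erase w)) := by
  have hr : r - 1 + 1 = r := Nat.sub_add_cancel (ht.card_eq ▸ card_pos.2 ⟨w, hw⟩)
  rw [← hr]
  refine SimpleGraph.IsNClique.insert ⟨ht.isClique.subset (erase_subset w t), ?_⟩ hv
  rw [card_erase_of_mem hw, ht.card_eq]

namespace IsTiling

protected lemma disjoint (hT : IsTiling G r 𝒯) (hs : s ∈ 𝒯) (ht : t ∈ 𝒯) (hst : s ≠ t) :
    Disjoint s t :=
  hT.pairwiseDisjoint hs ht hst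

lemma card_eq (hT : IsTiling G r 𝒯) (ht : t ∈ 𝒯) : #t = r :=
  (hT.isNClique t ht).card_eq

protected lemma empty : IsTiling G r ∅ := ⟨by simp, by simp⟩

protected lemma singleton (ht : G.IsNClique r t) : IsTiling G r {t} :=
  ⟨by simpa using ht, by simp⟩

protected lemma subset (hT : IsTiling G r 𝒯) (hs : 𝒮 ⊆ 𝒯) : IsTiling G r 𝒮 :=
  ⟨fun t ht => hT.isNClique t (hs ht), hT.pairwiseDisjoint.subset (coe_subset.2 hs)⟩

variable [DecidableEq V]

protected lemma card_biUnion (hT : IsTiling G r 𝒯) : #(𝒯.biUnion id) = r * #𝒯 := by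
  rw [card_biUnion hT.pairwiseDisjoint,
    sum_congr rfl fun t ht => show #(id t) = r from hT.card_eq ht, sum_const, smul_eq_mul, mul_comm]

lemma degIn_biUnion_id (hT : IsTiling G r 𝒯) (v : V) :
    degIn G (𝒯.biUnion id) v = ∑ t ∈ 𝒯, degIn G t v :=
  degIn_biUnion hT.pairwiseDisjoint v

lemma card_compl_add [Fintype V] (hT : IsTiling G r 𝒯) :
    #(𝒯.biUnion id)ᶜ + r * #𝒯 = Fintype.card V := by
  rw [← hT.card_biUnion, add_comm, card_add_card_compl]

lemma degIn_compl_add [Fintype V] (hT : IsTiling G r 𝒯) (v : V) :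
    degIn G (𝒯.biUnion id)ᶜ v + ∑ t ∈ 𝒯, degIn G t v = degIn G univ v := by
  rw [← hT.degIn_biUnion_id, compl_eq_univ_sdiff, add_comm, degIn_add_degIn_sdiff (subset_univ _)]

lemma notMem_biUnion_erase (hT : IsTiling G r 𝒯) (ht : t ∈ 𝒯) {v : V} (hv : v ∈ t) :
    v ∉ (𝒯.erase t).biUnion id := by
  simp only [mem_biUnion, mem_erase, id, not_exists, not_and, and_imp]
  exact fun s hst hs hvs => disjoint_left.1 (hT.disjoint hs ht hst) hvs hv

protected lemma union (hT : IsTiling G r 𝒯) (hS : IsTiling G r 𝒮)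
    (h : ∀ t ∈ 𝒯, ∀ s ∈ 𝒮, Disjoint t s) : IsTiling G r (𝒯 ∪ 𝒮) := by
  refine ⟨fun t ht => (mem_union.1 ht).elim (hT.isNClique t) (hS.isNClique t), ?_⟩
  rw [coe_union, Set.pairwiseDisjoint_union]
  exact ⟨hT.pairwiseDisjoint, hS.pairwiseDisjoint, fun t ht s hs _ => h t ht s hs⟩

protected lemma card_union (hr : r ≠ 0) (hT : IsTiling G r 𝒯) (h : ∀ t ∈ 𝒯, ∀ s ∈ 𝒮, Disjoint t s) :
    #(𝒯 ∪ 𝒮) = #𝒯 + #𝒮 := by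
  refine card_union_of_disjoint (disjoint_left.2 fun t ht hs => hr ?_)
  rw [← hT.card_eq ht, disjoint_self.1 (h t ht t hs), bot_eq_empty, card_empty]

protected lemma insert (ht : G.IsNClique r t) (hT : IsTiling G r 𝒯)
    (h : ∀ s ∈ 𝒯, Disjoint t s) :
    IsTiling G r (insert t 𝒯) :=
  (IsTiling.singleton ht).union hT (by simpa using h)

protected lemma card_insert (hr : r ≠ 0) (ht : G.IsNClique r t) (h : ∀ s ∈ 𝒯, Disjoint t s) :
    #(insert t 𝒯) = #𝒯 + 1 :=
  (IsTiling.card_union hr (IsTiling.singleton ht) (by simpa using h)).trans (add_comm _ _)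

lemma exists_replace {𝒮' : Finset (Finset V)} (hr : r ≠ 0) (hT : IsTiling G r 𝒯) (hS : 𝒮 ⊆ 𝒯)
    (hS' : IsTiling G r 𝒮')
    (h : ∀ s ∈ 𝒮', ∀ v ∈ s, v ∈ 𝒮.biUnion id ∨ v ∉ 𝒯.biUnion id) :
    IsTiling G r (𝒯 \ 𝒮 ∪ 𝒮') ∧ #(𝒯 \ 𝒮 ∪ 𝒮') + #𝒮 = #𝒯 + #𝒮' := by
  have hd : ∀ t ∈ 𝒯 \ 𝒮, ∀ s ∈ 𝒮', Disjoint t s := by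
    refine fun t ht s hs => disjoint_left.2 fun v hvt hvs => ?_
    obtain ⟨htT, htS⟩ := mem_sdiff.1 ht
    rcases h s hs v hvs with hv | hv
    · obtain ⟨t', ht', hvt'⟩ := mem_biUnion.1 hv
      exact disjoint_left.1 (hT.disjoint htT (hS ht') fun e => htS (e ▸ ht')) hvt hvt'
    · exact hv (mem_biUnion.2 ⟨t, htT, hvt⟩)
  have hT' := hT.subset (sdiff_subset (s := 𝒯) (t := 𝒮))
  refine ⟨hT'.union hS' hd, ?_⟩
  rw [hT'.card_union hr hd, ← card_sdiff_add_card_eq_card hS]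
  ring

end IsTiling

lemma hasDisjointTriangles_iff :
    HasDisjointTriangles G l ↔ ∃ 𝒯, IsTiling G 3 𝒯 ∧ #𝒯 = l := by
  classical
  constructor
  · rintro ⟨T, hT, hd⟩
    have hinj : Function.Injective T := fun i j hij => by
      by_contra hne
      have hempty : T i = ∅ := disjoint_self.1 (by simpa only [← hij] using hd i j hne)
      simpa [hempty] using (hT i).card_eq
    refine ⟨univ.image T, ⟨by simpa using hT, ?_⟩, by simp [card_image_of_injective _ hinj]⟩
    rw [coe_image, Set.InjOn.pairwiseDisjoint_image hinj.injOn]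
    exact fun i _ j _ hij => hd i j hij
  · rintro ⟨𝒯, hT, rfl⟩
    refine ⟨fun i => 𝒯.equivFin.symm i, fun i => hT.isNClique _ (coe_mem _), fun i j hij =>
      hT.disjoint (coe_mem _) (coe_mem _) fun h => hij ?_⟩
    exact 𝒯.equivFin.symm.injective (Subtype.ext h)

lemma IsTiling.hasDisjointTriangles (hT : IsTiling G 3 𝒯) : HasDisjointTriangles G #𝒯 :=
  hasDisjointTriangles_iff.2 ⟨𝒯, hT, rfl⟩

lemma exists_isTiling_of_induce {s : Set V} (h : HasDisjointTriangles (G.induce s) l) :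
    ∃ 𝒯, IsTiling G 3 𝒯 ∧ #𝒯 = l ∧ ∀ t ∈ 𝒯, (t : Set V) ⊆ s := by
  classical
  obtain ⟨𝒯, hT, rfl⟩ := hasDisjointTriangles_iff.1 h
  let e : s ↪ V := Function.Embedding.subtype (· ∈ s)
  have he : Function.Injective (Finset.map e) := map_injective e
  refine ⟨𝒯.image (Finset.map e), ⟨?_, ?_⟩, card_image_of_injective _ he, ?_⟩
  · simp only [forall_mem_image]
    exact fun t ht => ((hT.isNClique t ht).map (f := e)).mono
      ((SimpleGraph.map_le_iff_le_comap _ _ _).2 le_rfl)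
  · rw [coe_image, Set.InjOn.pairwiseDisjoint_image he.injOn]
    exact fun t ht t' ht' hne => (disjoint_map e).2 (hT.disjoint ht ht' hne)
  · simp only [forall_mem_image, coe_map]
    rintro t - _ ⟨v, -, rfl⟩
    exact v.2

lemma hasDisjointTriangles_of_induce {s : Set V} (h : HasDisjointTriangles (G.induce s) l) :
    HasDisjointTriangles G l := by
  obtain ⟨𝒯, hT, rfl, -⟩ := exists_isTiling_of_induce h
  exact hT.hasDisjointTriangles

lemma hasDisjointTriangles_succ_of_induce {s : Set V} (ht : G.IsNClique 3 t)
    (hst : Disjoint (t : Set V) s) (h : HasDisjointTriangles (G.induce s) l) :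
    HasDisjointTriangles G (l + 1) := by
  classical
  obtain ⟨𝒯, hT, rfl, hs⟩ := exists_isTiling_of_induce h
  have hd : ∀ t' ∈ 𝒯, Disjoint t t' := fun t' ht' =>
    disjoint_coe.1 (hst.mono_right (hs t' ht'))
  rw [← IsTiling.card_insert three_ne_zero ht hd]
  exact (hT.insert ht hd).hasDisjointTriangles

variable [DecidableEq V]

lemma IsTiling.hasDisjointTriangles_of_replace {𝒮' : Finset (Finset V)}
    (hT : IsTiling G 3 𝒯) (hS : 𝒮 ⊆ 𝒯) (hS' : IsTiling G 3 𝒮')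
    (h : ∀ s ∈ 𝒮', ∀ v ∈ s, v ∈ 𝒮.biUnion id ∨ v ∉ 𝒯.biUnion id)
    (hl : l + #𝒮 = #𝒯 + #𝒮') : HasDisjointTriangles G l := by
  obtain ⟨hrep, hcard⟩ := hT.exists_replace three_ne_zero hS hS' h
  exact hasDisjointTriangles_iff.2 ⟨_, hrep, by omega⟩

lemma IsTiling.hasDisjointTriangles_of_one (hT : IsTiling G 3 𝒯) (hs : G.IsNClique 3 s)
    (h : ∀ v ∈ s, v ∉ 𝒯.biUnion id) : HasDisjointTriangles G (#𝒯 + 1) :=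
  hT.hasDisjointTriangles_of_replace (empty_subset _) (IsTiling.singleton hs)
    (by simpa only [mem_singleton, forall_eq] using fun v hv => Or.inr (h v hv)) (by simp)

lemma IsTiling.hasDisjointTriangles_of_two {s₁ s₂ : Finset V} (hT : IsTiling G 3 𝒯) (ht : t ∈ 𝒯)
    (h₁ : G.IsNClique 3 s₁) (h₂ : G.IsNClique 3 s₂) (hd : Disjoint s₁ s₂)
    (hs : ∀ v ∈ s₁ ∪ s₂, v ∈ t ∨ v ∉ 𝒯.biUnion id) : HasDisjointTriangles G (#𝒯 + 1) := by
  have hd' : ∀ s ∈ ({s₂} : Finset (Finset V)), Disjoint s₁ s := by simpa using hd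
  refine hT.hasDisjointTriangles_of_replace (singleton_subset_iff.2 ht)
    ((IsTiling.singleton h₂).insert h₁ hd') ?_ ?_
  · simp only [forall_mem_insert, mem_singleton, forall_eq, singleton_biUnion, id]
    exact ⟨fun v hv => hs v (mem_union_left _ hv), fun v hv => hs v (mem_union_right _ hv)⟩
  · rw [IsTiling.card_insert three_ne_zero h₁ hd', card_singleton, card_singleton]

lemma IsTiling.hasDisjointTriangles_of_three {t' s₁ s₂ s₃ : Finset V} (hT : IsTiling G 3 𝒯)
    (ht : t ∈ 𝒯) (ht' : t' ∈ 𝒯) (htt' : t ≠ t')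
    (h₁ : G.IsNClique 3 s₁) (h₂ : G.IsNClique 3 s₂) (h₃ : G.IsNClique 3 s₃)
    (hd₁₂ : Disjoint s₁ s₂) (hd₁₃ : Disjoint s₁ s₃) (hd₂₃ : Disjoint s₂ s₃)
    (hs : ∀ v ∈ s₁ ∪ s₂ ∪ s₃, v ∈ t ∨ v ∈ t' ∨ v ∉ 𝒯.biUnion id) :
    HasDisjointTriangles G (#𝒯 + 1) := by
  have hd₃ : ∀ s ∈ ({s₃} : Finset (Finset V)), Disjoint s₂ s := by simpa using hd₂₃
  have hd : ∀ s ∈ ({s₂, s₃} : Finset (Finset V)), Disjoint s₁ s := by simp [hd₁₂, hd₁₃]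
  refine hT.hasDisjointTriangles_of_replace (𝒮 := {t, t'}) ?_
    (((IsTiling.singleton h₃).insert h₂ hd₃).insert h₁ hd) ?_ ?_
  · simp [insert_subset_iff, ht, ht']
  · simp only [forall_mem_insert, mem_singleton, forall_eq, biUnion_insert, singleton_biUnion, id,
      mem_union, or_assoc] at hs ⊢
    exact ⟨fun v hv => hs v (.inl hv), fun v hv => hs v (.inr (.inl hv)),
      fun v hv => hs v (.inr (.inr hv))⟩
  · rw [IsTiling.card_insert three_ne_zero h₁ hd, IsTiling.card_insert three_ne_zero h₂ hd₃,
      card_pair htt', card_singleton]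

end Tilings

section Path

variable {V : Type*} [DecidableEq V] {G : SimpleGraph V} {𝒯 : Finset (Finset V)}
  {s t t₀ : Finset V} {p u v w x y z a b c : V}

/-- There is no splitting of `t ∪ {u, v, w}` into triangles `u v p` and `w q r` with
`t = {p, q, r}`, for a triangle `t` and adjacent `u` and `v`. Maximality of a tiling that contains
`t` yields this. -/
def NoSplit (G : SimpleGraph V) (t : Finset V) (u v w : V) : Prop :=
  ∀ p ∈ t, G.Adj u p → G.Adj v p → degIn G (t.erase p) w ≤ 1

namespace NoSplit

lemma adj (h : NoSplit G t u v w) (hw : 2 ≤ degIn G t w) (hp : p ∈ t) (hup : G.Adj u p)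
    (hvp : G.Adj v p) : G.Adj w p := by
  by_contra hwp
  have := h p hp hup hvp
  rw [degIn_erase_of_not_adj hwp] at this
  omega

lemma not_adj (h : NoSplit G t u v w) (hw : 3 ≤ degIn G t w) (hp : p ∈ t) (hup : G.Adj u p) :
    ¬ G.Adj v p := fun hvp => by
  have hwp := h.adj (by omega) hp hup hvp
  have := h p hp hup hvp
  have := degIn_erase_add_one hp hwp
  omega

lemma degIn_add_degIn_le_three (ht : #t = 3) (h : NoSplit G t u v w) (hw : 3 ≤ degIn G t w) :
    degIn G t u + degIn G t v ≤ 3 :=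
  ht ▸ degIn_add_degIn_le fun _ hp => h.not_adj hw hp

lemma degIn_add_degIn_le_five (ht : #t = 3) (h : NoSplit G t u v w) (hw : 2 ≤ degIn G t w) :
    degIn G t u + degIn G t v ≤ 5 := by
  by_contra! hlt
  have hu := degIn_le_card (G := G) t u
  have hv := degIn_le_card (G := G) t v
  have huall := degIn_eq_card_iff.1 (show degIn G t u = #t by omega)
  have hvall := degIn_eq_card_iff.1 (show degIn G t v = #t by omega)
  have hwall := degIn_eq_card_iff.2 fun p hp => h.adj hw hp (huall p hp) (hvall p hp)
  have := h.degIn_add_degIn_le_three ht (by omega)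
  omega

end NoSplit

lemma weighted_degIn_le_of_noSplit (ht : #t = 3) (hzya : NoSplit G t z y a)
    (hxaz : NoSplit G t x a z) (hzxa : NoSplit G t z x a) (hzyx : NoSplit G t z y x)
    (hzxy : NoSplit G t z x y) :
    2 * degIn G t z + degIn G t x + degIn G t y + 2 * degIn G t a ≤ 12 := by
  have hx := ht ▸ degIn_le_card (G := G) t x
  have hy := ht ▸ degIn_le_card (G := G) t y
  have hz := ht ▸ degIn_le_card (G := G) t z
  have ha := ht ▸ degIn_le_card (G := G) t a
  have htight : ¬ (degIn G t z = 3 ∧ degIn G t x = 1 ∧ degIn G t y = 2 ∧ degIn G t a = 2) := by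
    rintro ⟨hz3, hx1, hy2, ha2⟩
    obtain ⟨p, hp, hxp⟩ : ∃ p ∈ t, G.Adj x p := by
      by_contra! hnone
      have := degIn_eq_zero_iff.2 hnone
      omega
    have hzp := degIn_eq_card_iff.1 (hz3.trans ht.symm) p hp
    have hyp := hzxy.adj hy2.ge hp hzp hxp
    exact hxaz.not_adj hz3.ge hp hxp (hzya.adj ha2.ge hp hzp hyp)
  have := hzya.degIn_add_degIn_le_three ht
  have := hxaz.degIn_add_degIn_le_three ht
  have := hzxa.degIn_add_degIn_le_three ht
  have := hzyx.degIn_add_degIn_le_three ht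
  have := hzxy.degIn_add_degIn_le_three ht
  have := hzya.degIn_add_degIn_le_five ht
  have := hzyx.degIn_add_degIn_le_five ht
  omega

lemma IsTiling.noSplit (hT : IsTiling G 3 𝒯) (hno : ¬ HasDisjointTriangles G (#𝒯 + 1))
    (ht₀ : t₀ ∈ 𝒯) (ht : t ∈ 𝒯.erase t₀) (huv : G.Adj u v) (hs : G.IsNClique 3 s)
    (hw : w ∉ ({u, v} : Finset V)) (hd : Disjoint s {u, v, w})
    (hmem : ∀ p ∈ {u, v, w} ∪ s, p ∈ t₀ ∨ p ∉ 𝒯.biUnion id) : NoSplit G t u v w := by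
  obtain ⟨htne, ht⟩ := mem_erase.1 ht
  refine fun p hp hup hvp => not_lt.1 fun hlt => hno ?_
  have hcard := (card_erase_add_one hp).trans (hT.card_eq ht)
  have hall : degIn G (t.erase p) w = #(t.erase p) := (degIn_le_card _ _).antisymm (by omega)
  have hmem_t : ∀ q ∈ t, q ∉ {u, v, w} ∪ s := fun q hqt hq => (hmem q hq).elim
    (disjoint_left.1 (hT.disjoint ht ht₀ htne) hqt) (· (mem_biUnion.2 ⟨t, ht, hqt⟩))
  have hmem_all : ∀ q ∈ {u, v, p} ∪ insert w (t.erase p) ∪ s,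
      q ∈ t₀ ∨ q ∈ t ∨ q ∉ 𝒯.biUnion id := fun q hq => by
    by_cases hqt : q ∈ t
    · exact .inr (.inl hqt)
    · refine (hmem q ?_).imp_right .inr
      simp only [mem_union, mem_insert, mem_erase, mem_singleton] at hq ⊢
      grind
  refine hT.hasDisjointTriangles_of_three ht₀ ht htne.symm (isNClique_triple huv hup hvp)
    (isNClique_insert_erase (hT.isNClique t ht) hp (degIn_eq_card_iff.1 hall)) hs ?_ ?_ ?_ hmem_all
  all_goals
    rw [disjoint_left] at hd ⊢
    simp only [mem_union, mem_insert, mem_erase, mem_singleton] at hd hw hmem_t ⊢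
    grind

/-- A tiling together with a path `x z y` on three vertices that it does not cover. -/
structure IsTilingWithPath (G : SimpleGraph V) (𝒯 : Finset (Finset V)) (x z y : V) : Prop where
  isTiling : IsTiling G 3 𝒯
  left_notMem : x ∉ 𝒯.biUnion id
  mid_notMem : z ∉ 𝒯.biUnion id
  right_notMem : y ∉ 𝒯.biUnion id
  ne : x ≠ y
  adj_left : G.Adj z x
  adj_right : G.Adj z y

namespace IsTilingWithPath

lemma symm (h : IsTilingWithPath G 𝒯 x z y) : IsTilingWithPath G 𝒯 y z x :=
  ⟨h.isTiling, h.right_notMem, h.mid_notMem, h.left_notMem, h.ne.symm, h.adj_right, h.adj_left⟩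

lemma mem_or_notMem (h : IsTilingWithPath G 𝒯 x z y) (t₀ : Finset V) :
    ∀ p ∈ {x, y, z} ∪ t₀, p ∈ t₀ ∨ p ∉ 𝒯.biUnion id := by
  intro p hp
  simp only [mem_union, mem_insert, mem_singleton] at hp
  rcases hp with (rfl | rfl | rfl) | hp
  exacts [.inr h.left_notMem, .inr h.right_notMem, .inr h.mid_notMem, .inl hp]

lemma nodup (h : IsTilingWithPath G 𝒯 x z y) (ht : {a, b, c} ∈ 𝒯) :
    [x, y, z, a, b, c].Nodup := by
  obtain ⟨hab, hac, hbc⟩ := SimpleGraph.is3Clique_triple_iff.1 (h.isTiling.isNClique _ ht)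
  have hout : ∀ v ∉ 𝒯.biUnion id, v ≠ a ∧ v ≠ b ∧ v ≠ c := fun v hv => by
    have := fun hvt => hv (mem_biUnion.2 ⟨_, ht, hvt⟩)
    simpa using this
  have hx := hout x h.left_notMem
  have hy := hout y h.right_notMem
  have hz := hout z h.mid_notMem
  simp [hx, hy, hz, h.ne, h.adj_left.ne', h.adj_right.ne', hab.ne, hac.ne, hbc.ne]

lemma weighted_degIn_le (h : IsTilingWithPath G 𝒯 x z y)
    (hno : ¬ HasDisjointTriangles G (#𝒯 + 1)) (ht₀ : {a, b, c} ∈ 𝒯) (hxa : G.Adj x a)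
    (hxb : G.Adj x b) (hxc : G.Adj x c) (hyb : G.Adj y b) (hyc : G.Adj y c)
    (ht : t ∈ 𝒯.erase {a, b, c}) :
    2 * degIn G t z + degIn G t x + degIn G t y + 2 * degIn G t a ≤ 12 := by
  have habc := h.isTiling.isNClique _ ht₀
  have hbc := (SimpleGraph.is3Clique_triple_iff.1 habc).2.2
  have hnd := h.nodup ht₀
  have noSplit {u v w : V} {s : Finset V} (huv : G.Adj u v) (hs : G.IsNClique 3 s)
      (hw : w ∉ ({u, v} : Finset V)) (hd : Disjoint s {u, v, w})
      (hsub : {u, v, w} ∪ s ⊆ {x, y, z} ∪ {a, b, c}) : NoSplit G t u v w :=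
    h.isTiling.noSplit hno ht₀ ht huv hs hw hd fun p hp => h.mem_or_notMem _ p (hsub hp)
  refine weighted_degIn_le_of_noSplit (h.isTiling.card_eq (mem_of_mem_erase ht))
    (noSplit h.adj_right (isNClique_triple hxb hxc hbc) ?_ ?_ ?_)
    (noSplit hxa (isNClique_triple hyb hyc hbc) ?_ ?_ ?_)
    (noSplit h.adj_left (isNClique_triple hyb hyc hbc) ?_ ?_ ?_)
    (noSplit h.adj_right habc ?_ ?_ ?_) (noSplit h.adj_left habc ?_ ?_ ?_)
  all_goals
    simp only [disjoint_left, subset_iff, mem_union, mem_insert, mem_singleton, List.nodup_cons,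
      List.mem_cons, List.not_mem_nil] at hnd ⊢
    grind

lemma not_adj_mid (h : IsTilingWithPath G 𝒯 x z y) (hno : ¬ HasDisjointTriangles G (#𝒯 + 1))
    (ht₀ : {a, b, c} ∈ 𝒯) (hxa : G.Adj x a) (hxb : G.Adj x b) (hxc : G.Adj x c)
    (hyb : G.Adj y b) (hyc : G.Adj y c) : ∀ v ∈ ({a, b, c} : Finset V), ¬ G.Adj z v := by
  obtain ⟨hab, hac, hbc⟩ := SimpleGraph.is3Clique_triple_iff.1 (h.isTiling.isNClique _ ht₀)
  have hnd := h.nodup ht₀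
  have no_two {s₁ s₂ : Finset V} (h₁ : G.IsNClique 3 s₁) (h₂ : G.IsNClique 3 s₂)
      (hd : Disjoint s₁ s₂) (hsub : s₁ ∪ s₂ ⊆ {x, y, z} ∪ {a, b, c}) : False :=
    hno (h.isTiling.hasDisjointTriangles_of_two ht₀ h₁ h₂ hd fun p hp =>
      h.mem_or_notMem _ p (hsub hp))
  simp only [mem_insert, mem_singleton, forall_eq_or_imp, forall_eq]
  refine ⟨fun hza => no_two (isNClique_triple h.adj_left hza hxa)
      (isNClique_triple hyb hyc hbc) ?_ ?_,
    fun hzb => no_two (isNClique_triple h.adj_right hzb hyb) (isNClique_triple hxa hxc hac) ?_ ?_,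
    fun hzc => no_two (isNClique_triple h.adj_right hzc hyc) (isNClique_triple hxa hxb hab) ?_ ?_⟩
  all_goals
    simp only [disjoint_left, subset_iff, mem_union, mem_insert, mem_singleton, List.nodup_cons,
      List.mem_cons, List.not_mem_nil] at hnd ⊢
    grind

/-- The vertices `z` and `a` get weight `2`, the vertices `x` and `y` weight `1`. Their weighted
degrees add up to at most `20` inside `{x, y, z, a, b, c}` and to at most `12` in each other
triangle, while the degree condition asks for `12 * (#𝒯 + 1)` in total. -/
lemma hasDisjointTriangles_of_adj [Fintype V] (h : IsTilingWithPath G 𝒯 x z y)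
    (hcard : Fintype.card V = 3 * (#𝒯 + 1)) (hdeg : ∀ v, 2 * (#𝒯 + 1) ≤ degIn G univ v)
    (hxy : ¬ G.Adj x y) (ht₀ : {a, b, c} ∈ 𝒯) (hxa : G.Adj x a) (hxb : G.Adj x b)
    (hxc : G.Adj x c) (hyb : G.Adj y b) (hyc : G.Adj y c) :
    HasDisjointTriangles G (#𝒯 + 1) := by
  by_contra hno
  set 𝒯' := 𝒯.erase {a, b, c}
  have h𝒯'card : #𝒯' + 1 = #𝒯 := card_erase_add_one ht₀
  have hT' : IsTiling G 3 𝒯' := h.isTiling.subset (erase_subset _ _)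
  set K := (𝒯'.biUnion id)ᶜ with hK
  have hKcard : #K = 6 := by
    have : #K + 3 * #𝒯' = Fintype.card V := hT'.card_compl_add
    omega
  have hKmem : {x, y, z} ∪ {a, b, c} ⊆ K := fun v hv => by
    have hsub := biUnion_subset_biUnion_of_subset_left id (erase_subset {a, b, c} 𝒯)
    rw [hK, mem_compl]
    obtain hvt | hvt := h.mem_or_notMem _ v hv
    exacts [h.isTiling.notMem_biUnion_erase ht₀ hvt, fun hv' => hvt (hsub hv')]
  have core {v : V} {B : Finset V} (hB : B ⊆ {x, y, z} ∪ {a, b, c})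
      (hadj : ∀ w ∈ B, ¬ G.Adj v w) : degIn G K v + #B ≤ 6 :=
    hKcard ▸ degIn_add_card_le (hB.trans hKmem) hadj
  have hnd := h.nodup ht₀
  simp only [List.nodup_cons, List.mem_cons, List.not_mem_nil, not_or] at hnd
  have hz := h.not_adj_mid hno ht₀ hxa hxb hxc hyb hyc
  have hKz : degIn G K z ≤ 2 := by
    simpa [hnd] using core (v := z) (B := {z, a, b, c}) (by grind) (by simpa using hz)
  have hKx : degIn G K x ≤ 4 := by
    simpa [hnd] using core (v := x) (B := {x, y}) (by grind) (by simpa using hxy)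
  have hKy : degIn G K y ≤ 4 := by
    simpa [hnd] using core (v := y) (B := {x, y}) (by grind)
      (by simpa using fun hyx => hxy hyx.symm)
  have hKa : degIn G K a ≤ 4 := by
    simpa [hnd] using core (v := a) (B := {z, a}) (by grind)
      (by simpa using fun haz => hz a (by simp) haz.symm)
  have hout := sum_le_card_nsmul 𝒯' _ 12 fun t =>
    h.weighted_degIn_le hno ht₀ hxa hxb hxc hyb hyc
  simp only [sum_add_distrib, ← mul_sum, smul_eq_mul] at hout
  have hsplit : ∀ v, 2 * (#𝒯 + 1) ≤ degIn G K v + ∑ t ∈ 𝒯', degIn G t v := fun v =>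
    (hdeg v).trans_eq (hT'.degIn_compl_add v).symm
  have := hsplit x
  have := hsplit y
  have := hsplit z
  have := hsplit a
  omega

lemma exists_five_le_degIn_add_degIn [Fintype V] (h : IsTilingWithPath G 𝒯 x z y)
    (hcard : Fintype.card V = 3 * (#𝒯 + 1)) (hdeg : ∀ v, 2 * (#𝒯 + 1) ≤ degIn G univ v)
    (hxy : ¬ G.Adj x y) : ∃ t ∈ 𝒯, 5 ≤ degIn G t x + degIn G t y := by
  have hcompl : ∀ v, ¬ G.Adj v x → ¬ G.Adj v y → degIn G (𝒯.biUnion id)ᶜ v + 2 ≤ 3 := by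
    intro v hvx hvy
    have hsub : ({x, y} : Finset V) ⊆ (𝒯.biUnion id)ᶜ := by
      simp only [insert_subset_iff, singleton_subset_iff, mem_compl]
      exact ⟨h.left_notMem, h.right_notMem⟩
    have hle := degIn_add_card_le hsub (v := v) (G := G) (by simpa using ⟨hvx, hvy⟩)
    have := h.isTiling.card_compl_add
    rw [card_pair h.ne] at hle
    omega
  have hx := hcompl x G.irrefl hxy
  have hy := hcompl y (fun hyx => hxy hyx.symm) G.irrefl
  by_contra! hlt
  have hsum := sum_le_card_nsmul 𝒯 _ 4 fun t ht => Nat.le_of_lt_succ (hlt t ht)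
  rw [sum_add_distrib, smul_eq_mul] at hsum
  have := (hdeg x).trans_eq (h.isTiling.degIn_compl_add x).symm
  have := (hdeg y).trans_eq (h.isTiling.degIn_compl_add y).symm
  omega

lemma hasDisjointTriangles_of_degIn_eq_three [Fintype V] (h : IsTilingWithPath G 𝒯 x z y)
    (hcard : Fintype.card V = 3 * (#𝒯 + 1)) (hdeg : ∀ v, 2 * (#𝒯 + 1) ≤ degIn G univ v)
    (hxy : ¬ G.Adj x y) (ht : t ∈ 𝒯) (hx : degIn G t x = 3) (hy : 2 ≤ degIn G t y) :
    HasDisjointTriangles G (#𝒯 + 1) := by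
  have htcard := h.isTiling.card_eq ht
  have hxall := degIn_eq_card_iff.1 (hx.trans htcard.symm)
  obtain ⟨a, b, c, rfl, hyb, hyc⟩ := exists_eq_triple_of_two_le_degIn htcard hy
  exact h.hasDisjointTriangles_of_adj hcard hdeg hxy ht (hxall a (by simp)) (hxall b (by simp))
    (hxall c (by simp)) hyb hyc

lemma hasDisjointTriangles [Fintype V] (h : IsTilingWithPath G 𝒯 x z y)
    (hcard : Fintype.card V = 3 * (#𝒯 + 1)) (hdeg : ∀ v, 2 * (#𝒯 + 1) ≤ degIn G univ v)
    (hxy : ¬ G.Adj x y) : HasDisjointTriangles G (#𝒯 + 1) := by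
  obtain ⟨t, ht, h5⟩ := h.exists_five_le_degIn_add_degIn hcard hdeg hxy
  have hx := h.isTiling.card_eq ht ▸ degIn_le_card (G := G) t x
  have hy := h.isTiling.card_eq ht ▸ degIn_le_card (G := G) t y
  obtain hx | hy : degIn G t x = 3 ∨ degIn G t y = 3 := by omega
  · exact h.hasDisjointTriangles_of_degIn_eq_three hcard hdeg hxy ht hx (by omega)
  · exact h.symm.hasDisjointTriangles_of_degIn_eq_three hcard hdeg (fun hyx => hxy hyx.symm) ht hy
      (by omega)

end IsTilingWithPath

end Path

section CorradiHajnal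

variable {V : Type*} {G : SimpleGraph V} {x y : V}

lemma isNClique_of_sup_edge {r : ℕ} {t : Finset V}
    (ht : (G ⊔ SimpleGraph.edge x y).IsNClique r t) (h : ¬ (x ∈ t ∧ y ∈ t)) : G.IsNClique r t := by
  refine ⟨fun a ha b hb hab => ?_, ht.card_eq⟩
  have hadj := ht.isClique ha hb hab
  rw [SimpleGraph.sup_adj, SimpleGraph.edge_adj] at hadj
  rw [mem_coe] at ha hb
  grind

lemma exists_isTilingWithPath [DecidableEq V] {𝒯 : Finset (Finset V)} (hne : x ≠ y)
    (hT : IsTiling (G ⊔ SimpleGraph.edge x y) 3 𝒯) (hno : ¬ HasDisjointTriangles G #𝒯) :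
    ∃ 𝒯' z, IsTilingWithPath G 𝒯' x z y ∧ #𝒯' + 1 = #𝒯 := by
  obtain ⟨t, ht, hxt, hyt⟩ : ∃ t ∈ 𝒯, x ∈ t ∧ y ∈ t := by
    by_contra! hnone
    refine hno (IsTiling.hasDisjointTriangles ⟨fun t ht => ?_, hT.pairwiseDisjoint⟩)
    exact isNClique_of_sup_edge (hT.isNClique t ht) fun h => hnone t ht h.1 h.2
  obtain ⟨z, hz⟩ : ((t.erase x).erase y).Nonempty := by
    rw [← card_pos, card_erase_of_mem (mem_erase.2 ⟨hne.symm, hyt⟩), card_erase_of_mem hxt,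
      hT.card_eq ht]
    norm_num
  simp only [mem_erase] at hz
  obtain ⟨hzy, hzx, hzt⟩ := hz
  have hadj : ∀ w ∈ t, z ≠ w → G.Adj z w := fun w hw hzw => by
    have := (hT.isNClique t ht).isClique hzt hw hzw
    rw [SimpleGraph.sup_adj, SimpleGraph.edge_adj] at this
    grind
  have hout := fun {v} (hv : v ∈ t) => hT.notMem_biUnion_erase ht hv
  refine ⟨𝒯.erase t, z, ⟨⟨fun s hs => ?_, (hT.subset (erase_subset t 𝒯)).pairwiseDisjoint⟩,
    hout hxt, hout hzt, hout hyt, hne, hadj x hxt hzx, hadj y hyt hzy⟩, card_erase_add_one ht⟩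
  refine isNClique_of_sup_edge (hT.isNClique s (mem_of_mem_erase hs)) fun hs' => hout hxt ?_
  exact mem_biUnion.2 ⟨s, hs, hs'.1⟩

lemma hasDisjointTriangles_top [Fintype V] {l : ℕ} (h : 3 * l ≤ Fintype.card V) :
    HasDisjointTriangles (⊤ : SimpleGraph V) l := by
  classical
  induction l with
  | zero => exact hasDisjointTriangles_iff.2 ⟨∅, IsTiling.empty, rfl⟩
  | succ l ih =>
    obtain ⟨𝒯, hT, rfl⟩ := hasDisjointTriangles_iff.1 (ih (by omega))
    have hcard := hT.card_compl_add
    obtain ⟨t, ht, htcard⟩ := exists_subset_card_eq (show 3 ≤ #(𝒯.biUnion id)ᶜ by omega)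
    exact hT.hasDisjointTriangles_of_one ⟨fun a _ b _ hab => hab, htcard⟩
      fun v hv => mem_compl.1 (ht hv)

theorem corradi_hajnal [Fintype V] {q : ℕ} (hcard : Fintype.card V = 3 * q)
    (hdeg : ∀ v, 2 * q ≤ degIn G univ v) : HasDisjointTriangles G q := by
  classical
  by_contra hno
  obtain ⟨H, ⟨hdeg, hno⟩, hmax⟩ := (Set.toFinite {H : SimpleGraph V |
    (∀ v, 2 * q ≤ degIn H univ v) ∧ ¬ HasDisjointTriangles H q}).exists_maximal ⟨G, hdeg, hno⟩
  obtain ⟨x, y, hne, hxy⟩ : ∃ x y, x ≠ y ∧ ¬ H.Adj x y := by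
    by_contra! hall
    have htop : H = ⊤ := top_le_iff.1 fun x y => hall x y
    exact hno (htop ▸ hasDisjointTriangles_top hcard.ge)
  have hadd : HasDisjointTriangles (H ⊔ SimpleGraph.edge x y) q := by
    by_contra hnot
    refine hxy (hmax ⟨fun v => (hdeg v).trans (degIn_mono_left le_sup_left _ _), hnot⟩
      le_sup_left ?_)
    simp [SimpleGraph.edge_adj, hne]
  obtain ⟨𝒯, hT, rfl⟩ := hasDisjointTriangles_iff.1 hadd
  obtain ⟨𝒯', z, hpath, hq⟩ := exists_isTilingWithPath hne hT hno
  rw [← hq] at hcard hdeg hno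
  exact hno (hpath.hasDisjointTriangles hcard hdeg hxy)

lemma hasDisjointTriangles_of_degIn {q : ℕ} {W : Finset V} (hW : #W = 3 * q)
    (hdeg : ∀ v ∈ W, 2 * q ≤ degIn G W v) : HasDisjointTriangles G q := by
  refine hasDisjointTriangles_of_induce (s := (W : Set V)) (corradi_hajnal ?_ fun v => ?_)
  · simpa using hW
  · exact degIn_induce (G := G) W v ▸ hdeg v v.2

end CorradiHajnal

section Sparse

variable {V : Type*} [DecidableEq V] {G : SimpleGraph V} {𝒯 M : Finset (Finset V)}
  {t f g : Finset V} {u v w x y : V}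

/-- A triangle tiling `𝒯` together with a matching `M` on vertices that `𝒯` does not cover. -/
structure IsTilingWithMatching (G : SimpleGraph V) (𝒯 M : Finset (Finset V)) : Prop where
  tiling : IsTiling G 3 𝒯
  matching : IsTiling G 2 M
  disjoint : Disjoint (𝒯.biUnion id) (M.biUnion id)

/-- The vertices that are covered neither by `𝒯` nor by `M`. -/
def unmatched [Fintype V] (𝒯 M : Finset (Finset V)) : Finset V :=
  (𝒯.biUnion id ∪ M.biUnion id)ᶜ

lemma mem_unmatched [Fintype V] :
    u ∈ unmatched 𝒯 M ↔ u ∉ 𝒯.biUnion id ∧ u ∉ M.biUnion id := by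
  rw [unmatched, mem_compl, mem_union, not_or]

lemma exists_eq_pair_of_isNClique_two (hf : G.IsNClique 2 f) : ∃ a b, G.Adj a b ∧ f = {a, b} := by
  obtain ⟨a, b, hab, rfl⟩ := card_eq_two.1 hf.card_eq
  exact ⟨a, b, hf.isClique (by simp) (by simp) hab, rfl⟩

namespace IsTilingWithMatching

lemma notMem_biUnion (h : IsTilingWithMatching G 𝒯 M) (hf : f ∈ M) (hv : v ∈ f) :
    v ∉ 𝒯.biUnion id :=
  disjoint_right.1 h.disjoint (mem_biUnion.2 ⟨f, hf, hv⟩)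

lemma degIn_edge_le_two (h : IsTilingWithMatching G 𝒯 M) (hf : f ∈ M) (x : V) :
    degIn G f x ≤ 2 :=
  (degIn_le_card f x).trans (h.matching.card_eq hf).le

lemma sum_degIn_edge_le_six (h : IsTilingWithMatching G 𝒯 M) (ht : t ∈ 𝒯) (hf : f ∈ M) :
    ∑ v ∈ f, degIn G t v ≤ 6 := by
  have hle : ∀ v ∈ f, degIn G t v ≤ 3 := fun v _ =>
    (degIn_le_card t v).trans (h.tiling.card_eq ht).le
  simpa only [h.matching.card_eq hf, smul_eq_mul] using sum_le_card_nsmul f _ 3 hle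

variable [Fintype V]

lemma card_unmatched_add (h : IsTilingWithMatching G 𝒯 M) :
    #(unmatched 𝒯 M) + 2 * #M + 3 * #𝒯 = Fintype.card V := by
  rw [← card_compl_add_card (𝒯.biUnion id ∪ M.biUnion id), card_union_of_disjoint h.disjoint,
    h.tiling.card_biUnion, h.matching.card_biUnion, unmatched]
  ring

lemma degIn_unmatched_add (h : IsTilingWithMatching G 𝒯 M) (v : V) :
    degIn G (unmatched 𝒯 M) v + ∑ f ∈ M, degIn G f v + ∑ t ∈ 𝒯, degIn G t v =
      degIn G univ v := by
  rw [← degIn_add_degIn_sdiff (subset_univ (𝒯.biUnion id ∪ M.biUnion id)),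
    degIn_union h.disjoint, h.tiling.degIn_biUnion_id, h.matching.degIn_biUnion_id,
    ← compl_eq_univ_sdiff, unmatched]
  ring

lemma insert_edge (h : IsTilingWithMatching G 𝒯 M) (huv : G.Adj u v) (hu : u ∈ unmatched 𝒯 M)
    (hv : v ∈ unmatched 𝒯 M) :
    IsTilingWithMatching G 𝒯 (insert {u, v} M) ∧ #(insert {u, v} M) = #M + 1 := by
  rw [mem_unmatched] at hu hv
  have hd : ∀ f ∈ M, Disjoint {u, v} f := fun f hf => by
    rw [disjoint_insert_left, disjoint_singleton_left]
    exact ⟨fun huf => hu.2 (mem_biUnion.2 ⟨f, hf, huf⟩),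
      fun hvf => hv.2 (mem_biUnion.2 ⟨f, hf, hvf⟩)⟩
  refine ⟨⟨h.tiling, h.matching.insert (isNClique_pair huv) hd, ?_⟩,
    IsTiling.card_insert two_ne_zero (isNClique_pair huv) hd⟩
  rw [biUnion_insert, disjoint_union_right, id, disjoint_insert_right, disjoint_singleton_right]
  exact ⟨⟨hu.1, hv.1⟩, h.disjoint⟩

lemma exists_exchange (h : IsTilingWithMatching G 𝒯 M) (ht : t ∈ 𝒯) (hx : x ∈ t)
    (hu : u ∈ unmatched 𝒯 M) (hadj : ∀ w ∈ t.erase x, G.Adj u w) :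
    ∃ 𝒯', IsTilingWithMatching G 𝒯' M ∧ #𝒯' = #𝒯 ∧
      insert x ((unmatched 𝒯 M).erase u) ⊆ unmatched 𝒯' M := by
  have hxT : x ∈ 𝒯.biUnion id := mem_biUnion.2 ⟨t, ht, hx⟩
  rw [mem_unmatched] at hu
  obtain ⟨htil, hcard⟩ := h.tiling.exists_replace three_ne_zero (singleton_subset_iff.2 ht)
    (IsTiling.singleton (isNClique_insert_erase (h.tiling.isNClique t ht) hx hadj)) (by
      simp only [mem_singleton, forall_eq, singleton_biUnion, id, forall_mem_insert]
      exact ⟨.inr hu.1, fun w hw => .inl (mem_of_mem_erase hw)⟩)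
  have hcover : (𝒯 \ {t} ∪ {insert u (t.erase x)}).biUnion id ⊆
      insert u ((𝒯.biUnion id).erase x) := by
    rw [union_biUnion, singleton_biUnion, sdiff_singleton_eq_erase]
    refine union_subset (fun w hw => mem_insert_of_mem (mem_erase.2 ⟨?_, ?_⟩))
      (insert_subset_insert _ (erase_subset_erase _ (subset_biUnion_of_mem id ht)))
    · rintro rfl
      exact h.tiling.notMem_biUnion_erase ht hx hw
    · exact biUnion_subset_biUnion_of_subset_left _ (erase_subset t 𝒯) hw
  refine ⟨_, ⟨htil, h.matching, ?_⟩, by simpa only [card_singleton, add_left_inj] using hcard, ?_⟩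
  · exact (disjoint_insert_left.2
      ⟨hu.2, h.disjoint.mono_left (erase_subset _ _)⟩).mono_left hcover
  · have hxM : x ∉ M.biUnion id := disjoint_left.1 h.disjoint hxT
    intro w hw
    simp only [mem_insert, mem_erase, mem_unmatched] at hw ⊢
    have := @hcover w
    simp only [mem_insert, mem_erase] at this
    grind

end IsTilingWithMatching

/-- A triangle tiling `𝒯` of the largest possible size with a matching `M` outside of it, where `M`
is as large as possible for all such pairs. -/
structure IsMaxTilingWithMatching [Fintype V] (G : SimpleGraph V) (𝒯 M : Finset (Finset V)) : Prop
    extends IsTilingWithMatching G 𝒯 M where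
  not_hasDisjointTriangles : ¬ HasDisjointTriangles G (#𝒯 + 1)
  card_matching_le : ∀ 𝒯' M', IsTilingWithMatching G 𝒯' M' → #𝒯' = #𝒯 → #M' ≤ #M

variable [Fintype V]

lemma exists_isMaxTilingWithMatching {k : ℕ} (hk : HasDisjointTriangles G k)
    (hno : ¬ HasDisjointTriangles G (k + 1)) :
    ∃ 𝒯 M, #𝒯 = k ∧ IsMaxTilingWithMatching G 𝒯 M := by
  classical
  obtain ⟨𝒯₀, h𝒯₀, hcard⟩ := hasDisjointTriangles_iff.1 hk
  obtain ⟨⟨𝒯, M⟩, hTM, hmax⟩ := exists_max_image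
    {p : Finset (Finset V) × Finset (Finset V) | IsTilingWithMatching G p.1 p.2 ∧ #p.1 = k}
    (#·.2) ⟨(𝒯₀, ∅), by simpa using ⟨⟨h𝒯₀, IsTiling.empty, by simp⟩, hcard⟩⟩
  simp only [mem_filter, mem_univ, true_and, Prod.forall] at hTM hmax
  obtain ⟨h, rfl⟩ := hTM
  exact ⟨𝒯, M, rfl, h, hno, fun 𝒯' M' h' hc => hmax 𝒯' M' ⟨h', hc⟩⟩

namespace IsMaxTilingWithMatching

lemma not_adj (h : IsMaxTilingWithMatching G 𝒯 M) (hu : u ∉ 𝒯.biUnion id)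
    (hv : v ∉ 𝒯.biUnion id) (hw : w ∉ 𝒯.biUnion id) (huv : G.Adj u v) (huw : G.Adj u w) :
    ¬ G.Adj v w := fun hvw =>
  h.not_hasDisjointTriangles (h.tiling.hasDisjointTriangles_of_one
    (isNClique_triple huv huw hvw) (by simp_all))

lemma not_adj_of_mem_unmatched (h : IsMaxTilingWithMatching G 𝒯 M) (hu : u ∈ unmatched 𝒯 M)
    (hv : v ∈ unmatched 𝒯 M) : ¬ G.Adj u v := fun huv => by
  obtain ⟨h', hcard⟩ := h.insert_edge huv hu hv
  have := h.card_matching_le _ _ h' rfl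
  omega

lemma degIn_edge_le_one (h : IsMaxTilingWithMatching G 𝒯 M) (hu : u ∈ unmatched 𝒯 M)
    (hf : f ∈ M) : degIn G f u ≤ 1 := by
  by_contra! hlt
  have hall := degIn_eq_card_iff.1
    ((degIn_le_card (G := G) f u).antisymm ((h.matching.card_eq hf).trans_le hlt))
  obtain ⟨v, w, hvw, rfl⟩ := exists_eq_pair_of_isNClique_two (h.matching.isNClique f hf)
  exact h.not_adj (mem_unmatched.1 hu).1 (h.notMem_biUnion hf (by simp))
    (h.notMem_biUnion hf (by simp)) (hall v (by simp)) (hall w (by simp)) hvw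

lemma degIn_univ_le (h : IsMaxTilingWithMatching G 𝒯 M) (hu : u ∈ unmatched 𝒯 M) :
    degIn G univ u ≤ #M + ∑ t ∈ 𝒯, degIn G t u := by
  have hunmatched : degIn G (unmatched 𝒯 M) u = 0 :=
    degIn_eq_zero_iff.2 fun v hv => h.not_adj_of_mem_unmatched hu hv
  have hmatched : ∑ f ∈ M, degIn G f u ≤ #M := by
    simpa only [smul_eq_mul, mul_one] using
      sum_le_card_nsmul M _ 1 fun f hf => h.degIn_edge_le_one hu hf
  have := h.degIn_unmatched_add u
  omega

lemma degIn_ne_two (h : IsMaxTilingWithMatching G 𝒯 M) (ht : t ∈ 𝒯) (hf : f ∈ M) (hg : g ∈ M)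
    (hfg : f ≠ g) (hx : x ∈ t) (hy : y ∈ t) (hxy : x ≠ y) (hxf : degIn G f x = 2) :
    degIn G g y ≠ 2 := fun hyg => by
  rw [← h.matching.card_eq hf, degIn_eq_card_iff] at hxf
  rw [← h.matching.card_eq hg, degIn_eq_card_iff] at hyg
  have hmem : ∀ {z e}, z ∈ t → e ∈ M → z ∉ e := fun hz he hze =>
    h.notMem_biUnion he hze (mem_biUnion.2 ⟨t, ht, hz⟩)
  refine h.not_hasDisjointTriangles (h.tiling.hasDisjointTriangles_of_two ht
    ((h.matching.isNClique f hf).insert hxf) ((h.matching.isNClique g hg).insert hyg) ?_ ?_)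
  · rw [disjoint_insert_left, mem_insert, not_or, disjoint_insert_right]
    exact ⟨⟨hxy, hmem hx hg⟩, hmem hy hf, h.matching.disjoint hf hg hfg⟩
  · simp only [mem_union, mem_insert]
    rintro v ((rfl | hv) | (rfl | hv))
    exacts [.inl hx, .inr (h.notMem_biUnion hf hv), .inl hy, .inr (h.notMem_biUnion hg hv)]

lemma sum_degIn_edge_le (h : IsMaxTilingWithMatching G 𝒯 M) (ht : t ∈ 𝒯) :
    (∀ f ∈ M, ∑ v ∈ f, degIn G t v ≤ 4) ∨
      ∃ g ∈ M, ∀ f ∈ M, f ≠ g → ∑ v ∈ f, degIn G t v ≤ 3 := by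
  have hle_one : ∀ f ∈ M, ∀ x, degIn G f x ≠ 2 → degIn G f x ≤ 1 := fun f hf x hne =>
    Nat.le_of_lt_succ (lt_of_le_of_ne (h.degIn_edge_le_two hf x) hne)
  have hthree : ∀ f ∈ M, (∀ x ∈ t, degIn G f x ≠ 2) → ∑ v ∈ f, degIn G t v ≤ 3 := by
    intro f hf hne
    rw [sum_degIn_comm]
    simpa only [h.tiling.card_eq ht, smul_eq_mul] using
      sum_le_card_nsmul t _ 1 fun x hx => hle_one f hf x (hne x hx)
  by_cases hx : ∃ x ∈ t, ∃ g ∈ M, degIn G g x = 2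
  swap
  · push Not at hx
    exact .inl fun f hf => (hthree f hf fun x hxt => hx x hxt f hf).trans (by norm_num)
  obtain ⟨x, hx, g, hg, hxg⟩ := hx
  by_cases hy : ∃ y ∈ t.erase x, ∃ f ∈ M, degIn G f y = 2
  · obtain ⟨y, hy, e, he, hye⟩ := hy
    obtain ⟨hyx, hyt⟩ := mem_erase.1 hy
    obtain rfl : e = g := by
      by_contra hne
      exact h.degIn_ne_two ht hg he (Ne.symm hne) hx hyt hyx.symm hxg hye
    refine .inr ⟨e, he, fun f hf hne => hthree f hf fun z hz => ?_⟩
    rcases eq_or_ne z x with rfl | hzx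
    · exact h.degIn_ne_two ht he hf hne.symm hyt hz hyx hye
    · exact h.degIn_ne_two ht he hf hne.symm hx hz hzx.symm hxg
  · push Not at hy
    refine .inl fun f hf => ?_
    rw [sum_degIn_comm, ← add_sum_erase _ _ hx]
    have hrest : ∑ y ∈ t.erase x, degIn G f y ≤ 2 := by
      simpa only [card_erase_of_mem hx, h.tiling.card_eq ht, smul_eq_mul] using
        sum_le_card_nsmul (t.erase x) _ 1 fun y hyt => hle_one f hf y (hy y hyt f hf)
    have := h.degIn_edge_le_two hf x
    omega

lemma sum_sum_degIn_edge_le (h : IsMaxTilingWithMatching G 𝒯 M) (ht : t ∈ 𝒯) :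
    ∑ f ∈ M, ∑ v ∈ f, degIn G t v ≤ 4 * #M ∨
      ∃ g ∈ M, ∑ f ∈ M, ∑ v ∈ f, degIn G t v + 3 ≤ 3 * #M + ∑ v ∈ g, degIn G t v := by
  refine (h.sum_degIn_edge_le ht).imp (fun hfour => ?_) ?_
  · simpa only [smul_eq_mul, mul_comm] using sum_le_card_nsmul _ _ _ hfour
  · rintro ⟨g, hg, hthree⟩
    refine ⟨g, hg, ?_⟩
    have := sum_le_card_nsmul (M.erase g) _ 3 fun f hf =>
      hthree f (mem_of_mem_erase hf) (ne_of_mem_erase hf)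
    rw [smul_eq_mul] at this
    have := card_erase_add_one hg
    rw [← add_sum_erase _ _ hg]
    omega

lemma degIn_le_one (h : IsMaxTilingWithMatching G 𝒯 M) (ht : t ∈ 𝒯) (hf : f ∈ M)
    (hsix : 6 ≤ ∑ v ∈ f, degIn G t v) (hu : u ∈ unmatched 𝒯 M) : degIn G t u ≤ 1 := by
  by_contra! hlt
  have htc := h.tiling.isNClique t ht
  obtain ⟨a, b, c, rfl, hub, huc⟩ := exists_eq_triple_of_two_le_degIn htc.card_eq hlt
  obtain ⟨hab, hac, hbc⟩ := SimpleGraph.is3Clique_triple_iff.1 htc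
  have hfull : ∀ v ∈ f, G.Adj a v := by
    rw [← degIn_eq_card_iff, h.matching.card_eq hf]
    rw [sum_degIn_comm, sum_insert (by simp [hab.ne, hac.ne]), sum_pair hbc.ne] at hsix
    have := h.degIn_edge_le_two hf a
    have := h.degIn_edge_le_two hf b
    have := h.degIn_edge_le_two hf c
    omega
  rw [mem_unmatched] at hu
  have huf : u ∉ f := fun huf => hu.2 (mem_biUnion.2 ⟨f, hf, huf⟩)
  have htT : {a, b, c} ⊆ 𝒯.biUnion id := subset_biUnion_of_mem id ht
  have hfT := fun v => h.notMem_biUnion hf (v := v)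
  simp only [insert_subset_iff, singleton_subset_iff] at htT
  refine h.not_hasDisjointTriangles (h.tiling.hasDisjointTriangles_of_two ht
    (isNClique_triple hub huc hbc) ((h.matching.isNClique f hf).insert hfull) ?_ ?_)
  · rw [disjoint_left]
    simp only [mem_insert, mem_singleton]
    grind [hab.ne, hac.ne]
  · simp only [mem_union, mem_insert, mem_singleton]
    grind

lemma degIn_eq_zero (h : IsMaxTilingWithMatching G 𝒯 M) (ht : t ∈ 𝒯) (hu : u ∈ unmatched 𝒯 M)
    (hv : v ∈ unmatched 𝒯 M) (huv : u ≠ v) (hthree : degIn G t u = 3) : degIn G t v = 0 := by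
  rw [← h.tiling.card_eq ht, degIn_eq_card_iff] at hthree
  refine degIn_eq_zero_iff.2 fun x hx hvx => ?_
  obtain ⟨𝒯', h', hcard, hsub⟩ :=
    h.exists_exchange ht hx hu fun w hw => hthree w (mem_of_mem_erase hw)
  obtain ⟨hM', hcard'⟩ := h'.insert_edge hvx
    (hsub (mem_insert_of_mem (mem_erase.2 ⟨huv.symm, hv⟩))) (hsub (mem_insert_self _ _))
  have := h.card_matching_le _ _ hM' hcard
  omega

lemma sum_degIn_unmatched_le (h : IsMaxTilingWithMatching G 𝒯 M) (ht : t ∈ 𝒯) :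
    ∑ u ∈ unmatched 𝒯 M, degIn G t u ≤ 2 * #(unmatched 𝒯 M) + 1 := by
  by_cases hu : ∃ u ∈ unmatched 𝒯 M, degIn G t u = 3
  · obtain ⟨u, hu, hthree⟩ := hu
    rw [← add_sum_erase _ _ hu, hthree, sum_eq_zero fun v hv => h.degIn_eq_zero ht hu
      (mem_of_mem_erase hv) (ne_of_mem_erase hv).symm hthree]
    have := card_pos.2 ⟨u, hu⟩
    omega
  · push Not at hu
    have := sum_le_card_nsmul (unmatched 𝒯 M) _ 2 fun u hut =>
      Nat.le_of_lt_succ (lt_of_le_of_ne ((degIn_le_card t u).trans (h.tiling.card_eq ht).le)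
        (hu u hut))
    rw [smul_eq_mul] at this
    omega

lemma le_sum_sum_degIn_of_mem_matching (h : IsMaxTilingWithMatching G 𝒯 M)
    (hdeg : ∀ v, Fintype.card V / 2 + 1 ≤ degIn G univ v)
    (htri : ∀ u v w, G.Adj u v → G.Adj u w → G.Adj v w →
      2 * Fintype.card V + #𝒯 ≤ degIn G univ u + degIn G univ v + degIn G univ w)
    (hf : f ∈ M) : 4 * #𝒯 + 1 ≤ ∑ v ∈ f, ∑ t ∈ 𝒯, degIn G t v := by
  obtain ⟨u, v, huv, rfl⟩ := exists_eq_pair_of_isNClique_two (h.matching.isNClique f hf)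
  have hcommon : #(univ : Finset V) < degIn G univ u + degIn G univ v := by
    have := hdeg u
    have := hdeg v
    rw [card_univ]
    omega
  obtain ⟨w, -, huw, hvw⟩ := exists_common_neighbor hcommon
  have hsum := htri u v w huv huw hvw
  have hw := degIn_lt_card (G := G) (mem_univ w)
  have hle : degIn G (𝒯.biUnion id)ᶜ u + degIn G (𝒯.biUnion id)ᶜ v ≤ #(𝒯.biUnion id)ᶜ :=
    degIn_add_degIn_le fun x hx hux hvx => h.not_adj (h.notMem_biUnion hf (by simp))
      (h.notMem_biUnion hf (by simp)) (mem_compl.1 hx) huv hux hvx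
  have := h.tiling.card_compl_add
  have := h.tiling.degIn_compl_add u
  have := h.tiling.degIn_compl_add v
  rw [card_univ] at hw
  rw [sum_pair huv.ne]
  omega

lemma card_mul_le_sum_sum_degIn_edge (h : IsMaxTilingWithMatching G 𝒯 M)
    (hdeg : ∀ v, Fintype.card V / 2 + 1 ≤ degIn G univ v)
    (htri : ∀ u v w, G.Adj u v → G.Adj u w → G.Adj v w →
      2 * Fintype.card V + #𝒯 ≤ degIn G univ u + degIn G univ v + degIn G univ w) :
    #M * (4 * #𝒯 + 1) ≤ ∑ t ∈ 𝒯, ∑ f ∈ M, ∑ v ∈ f, degIn G t v := by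
  rw [sum_comm, sum_congr rfl fun f _ => sum_comm, ← smul_eq_mul]
  exact card_nsmul_le_sum M _ _ fun f => h.le_sum_sum_degIn_of_mem_matching hdeg htri

lemma card_mul_le_sum_sum_degIn_unmatched (h : IsMaxTilingWithMatching G 𝒯 M)
    (hn : 4 * #𝒯 + 3 ≤ Fintype.card V) (hdeg : ∀ v, Fintype.card V / 2 + 1 ≤ degIn G univ v) :
    #(unmatched 𝒯 M) * (2 * #𝒯 + 2) ≤
      ∑ t ∈ 𝒯, ∑ u ∈ unmatched 𝒯 M, degIn G t u + #(unmatched 𝒯 M) * #M := by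
  have hle : ∀ u ∈ unmatched 𝒯 M, 2 * #𝒯 + 2 ≤ ∑ t ∈ 𝒯, degIn G t u + #M := fun u hu => by
    have := h.degIn_univ_le hu
    have := hdeg u
    omega
  simpa only [smul_eq_mul, sum_add_distrib, sum_const, sum_comm (t := 𝒯)] using
    card_nsmul_le_sum _ _ _ hle

lemma card_matching_le_two (h : IsMaxTilingWithMatching G 𝒯 M)
    (hdeg : ∀ v, Fintype.card V / 2 + 1 ≤ degIn G univ v)
    (htri : ∀ u v w, G.Adj u v → G.Adj u w → G.Adj v w →
      2 * Fintype.card V + #𝒯 ≤ degIn G univ u + degIn G univ v + degIn G univ w) : #M ≤ 2 := by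
  by_contra! hM
  have hfour : ∀ t ∈ 𝒯, ∑ f ∈ M, ∑ v ∈ f, degIn G t v ≤ 4 * #M := fun t ht => by
    rcases h.sum_sum_degIn_edge_le ht with hle | ⟨g, hg, hle⟩
    · exact hle
    · have := h.sum_degIn_edge_le_six ht hg
      omega
  have hupper := sum_le_card_nsmul _ _ _ hfour
  have hlower := h.card_mul_le_sum_sum_degIn_edge hdeg htri
  rw [smul_eq_mul] at hupper
  nlinarith

lemma one_lt_card_matching (h : IsMaxTilingWithMatching G 𝒯 M)
    (hn : 4 * #𝒯 + 3 ≤ Fintype.card V) (hdeg : ∀ v, Fintype.card V / 2 + 1 ≤ degIn G univ v) :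
    1 < #M := by
  by_contra! hM
  have hupper := sum_le_card_nsmul _ _ _ fun t => h.sum_degIn_unmatched_le (t := t)
  have hlower := h.card_mul_le_sum_sum_degIn_unmatched hn hdeg
  have hcard := h.card_unmatched_add
  rw [smul_eq_mul] at hupper
  interval_cases #M <;> nlinarith

lemma card_matching_ne_two (h : IsMaxTilingWithMatching G 𝒯 M)
    (hn : 4 * #𝒯 + 3 ≤ Fintype.card V) (hdeg : ∀ v, Fintype.card V / 2 + 1 ≤ degIn G univ v)
    (htri : ∀ u v w, G.Adj u v → G.Adj u w → G.Adj v w →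
      2 * Fintype.card V + #𝒯 ≤ degIn G univ u + degIn G univ v + degIn G univ w) : #M ≠ 2 := by
  intro hM
  set I := unmatched 𝒯 M
  set 𝒩 := {t ∈ 𝒯 | 9 ≤ ∑ f ∈ M, ∑ v ∈ f, degIn G t v} with h𝒩
  have hedge : ∀ t ∈ 𝒯, 9 ≤ ∑ f ∈ M, ∑ v ∈ f, degIn G t v →
      ∑ f ∈ M, ∑ v ∈ f, degIn G t v ≤ 9 ∧ ∃ g ∈ M, 6 ≤ ∑ v ∈ g, degIn G t v := by
    intro t ht hnine
    obtain hle | ⟨g, hg, hle⟩ := h.sum_sum_degIn_edge_le ht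
    · omega
    · have := h.sum_degIn_edge_le_six ht hg
      exact ⟨by omega, g, hg, by omega⟩
  have hsum_edge : ∑ t ∈ 𝒯, ∑ f ∈ M, ∑ v ∈ f, degIn G t v ≤ 8 * #𝒯 + #𝒩 := by
    rw [h𝒩, card_filter, mul_comm, ← smul_eq_mul, ← sum_const, ← sum_add_distrib]
    refine sum_le_sum fun t ht => ?_
    have := hedge t ht
    split_ifs <;> omega
  have hsum_unmatched :
      ∑ t ∈ 𝒯, ∑ u ∈ I, degIn G t u + #𝒩 * (#I + 1) ≤ #𝒯 * (2 * #I + 1) := by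
    rw [h𝒩, ← smul_eq_mul, ← sum_const, sum_filter, ← sum_add_distrib, ← smul_eq_mul]
    refine sum_le_card_nsmul _ _ _ fun t ht => ?_
    split_ifs with hnine
    · obtain ⟨-, g, hg, hsix⟩ := hedge t ht hnine
      have := sum_le_card_nsmul I _ 1 fun u hu => h.degIn_le_one ht hg hsix hu
      rw [smul_eq_mul] at this
      omega
    · exact h.sum_degIn_unmatched_le ht
  have hlower_edge := h.card_mul_le_sum_sum_degIn_edge hdeg htri
  have hlower_unmatched := h.card_mul_le_sum_sum_degIn_unmatched hn hdeg
  have hcard := h.card_unmatched_add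
  rw [hM] at hlower_edge hlower_unmatched hcard
  have : 2 ≤ #𝒩 := by omega
  nlinarith

end IsMaxTilingWithMatching

end Sparse

lemma hasDisjointTriangles_succ_of_sparse {V : Type*} [Fintype V] {G : SimpleGraph V} {k : ℕ}
    (hn : 4 * k + 3 ≤ Fintype.card V)
    (hdeg : ∀ v, Fintype.card V / 2 + 1 ≤ degIn G univ v)
    (htri : ∀ u v w, G.Adj u v → G.Adj u w → G.Adj v w →
      2 * Fintype.card V + k ≤ degIn G univ u + degIn G univ v + degIn G univ w)
    (hk : HasDisjointTriangles G k) : HasDisjointTriangles G (k + 1) := by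
  classical
  by_contra hno
  obtain ⟨𝒯, M, rfl, h⟩ := exists_isMaxTilingWithMatching hk hno
  exact h.card_matching_ne_two hn hdeg htri
    ((h.card_matching_le_two hdeg htri).antisymm (h.one_lt_card_matching hn hdeg))

section Dense

variable {V : Type*} {G : SimpleGraph V} {A B L H W S : Finset V} {v w : V}

open Classical in
/-- The vertices of `A` that lie in no triangle of the graph induced on `A`. -/
noncomputable def outsideTriangles (G : SimpleGraph V) (A : Finset V) : Finset V :=
  {v ∈ A | ∀ w ∈ A, ∀ x ∈ A, G.Adj v w → G.Adj v x → ¬ G.Adj w x}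

lemma mem_outsideTriangles : v ∈ outsideTriangles G A ↔
    v ∈ A ∧ ∀ w ∈ A, ∀ x ∈ A, G.Adj v w → G.Adj v x → ¬ G.Adj w x := by
  simp [outsideTriangles]

lemma mem_outsideTriangles_of_subset (hBA : B ⊆ A) (hv : v ∈ outsideTriangles G A) (hvB : v ∈ B) :
    v ∈ outsideTriangles G B :=
  mem_outsideTriangles.2 ⟨hvB, fun w hw x hx =>
    (mem_outsideTriangles.1 hv).2 w (hBA hw) x (hBA hx)⟩

lemma degIn_add_degIn_le_of_mem_outsideTriangles (hv : v ∈ outsideTriangles G A) (hw : w ∈ A)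
    (hvw : G.Adj v w) : degIn G A v + degIn G A w ≤ #A :=
  degIn_add_degIn_le fun x hx => (mem_outsideTriangles.1 hv).2 w hw x hx hvw

section DegSum

variable [DecidableEq V]

lemma degSum_union_of_not_adj (hLH : Disjoint L H) (h : ∀ v ∈ L, ∀ w ∈ H, ¬ G.Adj v w) :
    degSum G (L ∪ H) = degSum G L + degSum G H := by
  rw [degSum, degSum, degSum, sum_union hLH]
  congr 1 <;> refine sum_congr rfl fun v hv => ?_ <;> rw [degIn_union hLH]
  · rw [degIn_eq_zero_iff.2 (h v hv), add_zero]
  · rw [degIn_eq_zero_iff.2 fun w hw hvw => h w hw v hv hvw.symm, zero_add]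

lemma erase_erase_union (hLH : Disjoint L H) (hv : v ∈ L) (hw : w ∈ H) :
    ((L ∪ H).erase v).erase w = L.erase v ∪ H.erase w := by
  rw [erase_union_distrib, erase_eq_of_notMem (disjoint_left.1 hLH hv), erase_union_distrib,
    erase_eq_of_notMem fun h => disjoint_right.1 hLH hw (mem_of_mem_erase h)]

lemma degSum_union_le (hLH : Disjoint L H) (hL : L ⊆ outsideTriangles G (L ∪ H)) :
    degSum G (L ∪ H) + #H ≤ #H * #H + #L * (#L + 1) := by
  induction L using Finset.strongInduction generalizing H with
  | _ L ih =>
    by_cases hadj : ∃ v ∈ L, ∃ w ∈ H, G.Adj v w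
    · obtain ⟨v, hv, w, hw, hvw⟩ := hadj
      have hsub : L.erase v ∪ H.erase w ⊆ L ∪ H :=
        union_subset_union (erase_subset _ _) (erase_subset _ _)
      have hrest := ih (L.erase v) (erase_ssubset hv)
        (hLH.mono (erase_subset _ _) (erase_subset _ _)) fun x hx =>
          mem_outsideTriangles_of_subset hsub (hL (mem_of_mem_erase hx)) (mem_union_left _ hx)
      have hsum := degSum_add_two_of_adj (mem_union_left H hv) (mem_union_right L hw) hvw
      have hvw_le :=
        degIn_add_degIn_le_of_mem_outsideTriangles (hL hv) (mem_union_right L hw) hvw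
      rw [erase_erase_union hLH hv hw] at hsum
      rw [card_union_of_disjoint hLH] at hvw_le
      rw [← card_erase_add_one hv, ← card_erase_add_one hw] at hvw_le ⊢
      nlinarith
    · push Not at hadj
      rw [degSum_union_of_not_adj hLH hadj]
      have := degSum_add_card_le (G := G) L
      have := degSum_add_card_le (G := G) H
      nlinarith

lemma two_mul_degSum_union_le (hLH : Disjoint L H) (hL : L ⊆ outsideTriangles G (L ∪ H)) :
    2 * degSum G (L ∪ H) + 2 * #H ≤ 2 * (#H * #H) + (#L + #H) ^ 2 := by
  induction L using Finset.strongInduction generalizing H with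
  | _ L ih =>
    by_cases hadj : ∃ v ∈ L, ∃ w ∈ L ∪ H, G.Adj v w
    · obtain ⟨v, hv, w, hw, hvw⟩ := hadj
      have hsum := degSum_add_two_of_adj (mem_union_left H hv) hw hvw
      have hvw_le := degIn_add_degIn_le_of_mem_outsideTriangles (hL hv) hw hvw
      rw [card_union_of_disjoint hLH] at hvw_le
      have hrest : ∀ {L' H'}, L' ⊆ L.erase v → H' ⊆ H →
          2 * degSum G (L' ∪ H') + 2 * #H' ≤ 2 * (#H' * #H') + (#L' + #H') ^ 2 := by
        intro L' H' hL' hH'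
        have hL'L := hL'.trans (erase_subset v L)
        exact ih L' (hL'.trans_ssubset (erase_ssubset hv)) (hLH.mono hL'L hH') fun x hx =>
          mem_outsideTriangles_of_subset (union_subset_union hL'L hH') (hL (hL'L hx))
            (mem_union_left _ hx)
      rcases mem_union.1 hw with hwL | hwH
      · have hwLv : w ∈ L.erase v := mem_erase.2 ⟨hvw.ne', hwL⟩
        have := hrest (erase_subset w _) subset_rfl
        rw [erase_union_distrib, erase_eq_of_notMem (disjoint_left.1 hLH hv), erase_union_distrib,
          erase_eq_of_notMem (disjoint_left.1 hLH hwL)] at hsum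
        rw [← card_erase_add_one hv, ← card_erase_add_one hwLv] at hvw_le ⊢
        nlinarith
      · have := hrest subset_rfl (erase_subset w H)
        rw [erase_erase_union hLH hv hwH] at hsum
        rw [← card_erase_add_one hv, ← card_erase_add_one hwH] at hvw_le ⊢
        nlinarith
    · push Not at hadj
      rw [degSum_union_of_not_adj hLH fun v hv w hw => hadj v hv w (mem_union_right L hw),
        show degSum G L = 0 from sum_eq_zero fun v hv =>
          degIn_eq_zero_iff.2 fun w hw => hadj v hv w (mem_union_left H hw)]
      have := degSum_add_card_le (G := G) H
      nlinarith [Nat.zero_le ((#L + #H) ^ 2)]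

end DegSum

lemma degIn_le_degIn_sdiff_add_card [DecidableEq V] (h : A ⊆ B) (v : V) :
    degIn G B v ≤ degIn G (B \ A) v + #A := by
  rw [← degIn_add_degIn_sdiff h, add_comm]
  exact Nat.add_le_add_left (degIn_le_card A v) _

lemma exists_subset_card_eq_and_comparable {α : Type*} {B H : Finset α} {m : ℕ} (hBH : B ⊆ H)
    (hm : m ≤ #H) : ∃ W ⊆ H, #W = m ∧ (W ⊆ B ∨ B ⊆ W) := by
  rcases le_total m #B with hmB | hmB
  · obtain ⟨W, hWB, hW⟩ := exists_subset_card_eq hmB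
    exact ⟨W, hWB.trans hBH, hW, .inl hWB⟩
  · obtain ⟨W, hBW, hWH, hW⟩ := exists_subsuperset_card_eq hBH hmB hm
    exact ⟨W, hWH, hW, .inr hBW⟩

variable [Fintype V] {k μ : ℕ}

lemma degIn_add_card_outsideTriangles_lt
    (hdeg : ∀ v, #(outsideTriangles G univ) < degIn G univ v) (v : V) :
    degIn G univ v + #(outsideTriangles G univ) < Fintype.card V := by
  classical
  have hadj : ∀ {u w}, u ∈ outsideTriangles G univ ∨ w ∈ outsideTriangles G univ → G.Adj u w →
      degIn G univ u + degIn G univ w ≤ Fintype.card V := by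
    rintro u w (hu | hw) huw
    · exact degIn_add_degIn_le_of_mem_outsideTriangles hu (mem_univ w) huw
    · rw [add_comm]
      exact degIn_add_degIn_le_of_mem_outsideTriangles hw (mem_univ u) huw.symm
  by_cases hw : ∃ w, G.Adj v w ∧ (v ∈ outsideTriangles G univ ∨ w ∈ outsideTriangles G univ)
  · obtain ⟨w, hvw, hmem⟩ := hw
    have := hadj hmem hvw
    have := hdeg w
    omega
  · push Not at hw
    have hv : v ∉ outsideTriangles G univ := fun hv => by
      have hzero : degIn G univ v = 0 := degIn_eq_zero_iff.2 fun w _ hvw => (hw w hvw).1 hv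
      have := hdeg v
      omega
    have hle := degIn_add_card_le (subset_univ (insert v (outsideTriangles G univ)))
      ((forall_mem_insert _ _ _).2 ⟨G.irrefl, fun w hwL hvw => (hw w hvw).2 hwL⟩)
    rw [card_insert_of_notMem hv, card_univ] at hle
    omega

lemma le_degIn_of_notMem_outsideTriangles
    (hdeg : ∀ v, #(outsideTriangles G univ) < degIn G univ v)
    (htri : ∀ u v w, G.Adj u v → G.Adj u w → G.Adj v w → 2 * Fintype.card V + 2 * k ≤
      degIn G univ u + degIn G univ v + degIn G univ w)
    (hv : v ∉ outsideTriangles G univ) :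
    2 * k + 2 + 2 * #(outsideTriangles G univ) ≤ degIn G univ v := by
  simp only [mem_outsideTriangles, mem_univ, true_and, forall_const] at hv
  push Not at hv
  obtain ⟨w, x, hvw, hvx, hwx⟩ := hv
  have := htri v w x hvw hvx hwx
  have := degIn_add_card_outsideTriangles_lt hdeg w
  have := degIn_add_card_outsideTriangles_lt hdeg x
  omega

lemma not_adj_of_degIn_lt (hn : Fintype.card V ≤ 4 * k + 2)
    (hdeg : ∀ v, #(outsideTriangles G univ) < degIn G univ v)
    (htri : ∀ u v w, G.Adj u v → G.Adj u w → G.Adj v w → 2 * Fintype.card V + 2 * k ≤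
      degIn G univ u + degIn G univ v + degIn G univ w)
    (hv : v ∉ outsideTriangles G univ) (hw : w ∉ outsideTriangles G univ)
    (hv_lt : 2 * degIn G univ v < Fintype.card V + 2 * k + 1 + #(outsideTriangles G univ))
    (hw_lt : 2 * degIn G univ w < Fintype.card V + 2 * k + 1 + #(outsideTriangles G univ)) :
    ¬ G.Adj v w := fun hvw => by
  have hv_le := le_degIn_of_notMem_outsideTriangles hdeg htri hv
  have hw_le := le_degIn_of_notMem_outsideTriangles hdeg htri hw
  obtain ⟨x, -, hvx, hwx⟩ := exists_common_neighbor (G := G) (A := univ) (u := v) (v := w)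
    (by rw [card_univ]; omega)
  have := htri v w x hvw hvx hwx
  have := degIn_add_card_outsideTriangles_lt hdeg x
  omega

/- The vertices of degree at least `(n + 2k + 1 + |L|) / 2` have few non-neighbours, and those of
smaller degree are joined to many of them; so the minimum degree condition holds on every set of
`3 (k + 1)` vertices that prefers the former. -/
lemma hasDisjointTriangles_of_card_outsideTriangles_lt
    (hn : Fintype.card V = 3 * k + 2 + μ) (hμk : μ ≤ k) (hdeg : ∀ v, μ < degIn G univ v)
    (htri : ∀ u v w, G.Adj u v → G.Adj u w → G.Adj v w → 2 * Fintype.card V + 2 * k ≤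
      degIn G univ u + degIn G univ v + degIn G univ w)
    (hμ : #(outsideTriangles G univ) < μ) : HasDisjointTriangles G (k + 1) := by
  classical
  set L := outsideTriangles G univ
  replace hdeg : ∀ v, #L < degIn G univ v := fun v => hμ.trans (hdeg v)
  set B := {v ∈ Lᶜ | Fintype.card V + 2 * k + 1 + #L ≤ 2 * degIn G univ v}
  have hBL : B ⊆ Lᶜ := filter_subset _ _
  have hcard := card_compl_add_card L
  have hdegL : ∀ v, degIn G univ v ≤ degIn G Lᶜ v + #L := fun v => by
    rw [compl_eq_univ_sdiff]
    exact degIn_le_degIn_sdiff_add_card (subset_univ L) v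
  obtain ⟨W, hWL, hW, hWB⟩ := exists_subset_card_eq_and_comparable (m := 3 * (k + 1)) hBL (by omega)
  refine hasDisjointTriangles_of_degIn hW fun v hvW => ?_
  have hvL := hWL hvW
  have := hdegL v
  by_cases hvB : v ∈ B
  · have hv_le := (mem_filter.1 hvB).2
    have := degIn_le_degIn_sdiff_add_card (G := G) (sdiff_subset (s := Lᶜ) (t := W)) v
    rw [Finset.sdiff_sdiff_eq_self hWL, card_sdiff_of_subset hWL] at this
    omega
  · have hBW : B ⊆ W := hWB.resolve_left fun hWB => hvB (hWB hvW)
    have hv_le : 2 * k + 2 + 2 * #L ≤ degIn G univ v :=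
      le_degIn_of_notMem_outsideTriangles hdeg htri (mem_compl.1 hvL)
    have hlow : ∀ w ∈ Lᶜ, w ∉ B → 2 * degIn G univ w < Fintype.card V + 2 * k + 1 + #L :=
      fun w hw hwB => not_le.1 fun hle => hwB (mem_filter.2 ⟨hw, hle⟩)
    have hindep : degIn G (Lᶜ \ B) v = 0 := degIn_eq_zero_iff.2 fun w hw => by
      obtain ⟨hwL, hwB⟩ := mem_sdiff.1 hw
      exact not_adj_of_degIn_lt (by omega) hdeg htri (mem_compl.1 hvL) (mem_compl.1 hwL)
        (hlow v hvL hvB) (hlow w hwL hwB)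
    have := degIn_add_degIn_sdiff (G := G) hBL v
    have := degIn_mono (G := G) hBW v
    omega

lemma hasDisjointTriangles_or_degSum_le (hn : Fintype.card V = 3 * k + 2 + μ) (hμk : μ ≤ k)
    (hdeg : ∀ v, μ < degIn G univ v)
    (htri : ∀ u v w, G.Adj u v → G.Adj u w → G.Adj v w → 2 * Fintype.card V + 2 * k ≤
      degIn G univ u + degIn G univ v + degIn G univ w) :
    HasDisjointTriangles G (k + 1) ∨
      degSum G univ ≤ (3 * k + 2) * (3 * k + 1) + μ * (μ + 1) ∨
      degSum G univ ≤ (2 * k + 1) * (2 * k) + 2 * ((2 * k + 1) * (k + 1 + μ)) := by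
  classical
  set L := outsideTriangles G univ
  rcases Nat.lt_or_ge #L μ with hμ | hμ
  · exact .inl (hasDisjointTriangles_of_card_outsideTriangles_lt hn hμk hdeg htri hμ)
  have hcard := (card_compl_add_card L).trans hn
  have hunion : L ∪ Lᶜ = univ := union_compl L
  have hLsub : L ⊆ outsideTriangles G (L ∪ Lᶜ) := by rw [hunion]
  rcases Nat.lt_or_ge #L (3 * k + 2) with hL_lt | hL_le
  · refine .inr (.inl ?_)
    have hsum := degSum_union_le disjoint_compl_right hLsub
    obtain ⟨i, hi⟩ := Nat.exists_eq_add_of_le hμ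
    obtain ⟨j, hj⟩ := Nat.exists_eq_add_of_lt hL_lt
    rw [hunion, show #Lᶜ = j + 1 + μ by omega, hi] at hsum
    rw [show 3 * k + 2 = μ + i + j + 1 by omega, show 3 * k + 1 = μ + i + j by omega]
    nlinarith [Nat.zero_le (i * j)]
  · refine .inr (.inr ?_)
    have hsum := two_mul_degSum_union_le disjoint_compl_right hLsub
    obtain ⟨i, hi⟩ := Nat.exists_eq_add_of_le (show #Lᶜ ≤ μ by omega)
    obtain ⟨j, rfl⟩ := Nat.exists_eq_add_of_le hμk
    rw [hunion, add_comm #L, hcard] at hsum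
    subst hi
    nlinarith [Nat.le_mul_self i, Nat.zero_le (#Lᶜ * i), Nat.zero_le ((#Lᶜ + i) * j),
      Nat.zero_le ((#Lᶜ + i) * (#Lᶜ + i)), Nat.zero_le (j * j)]

end Dense

/-- The number of edges of `E₁(n,k)`. -/
def num₁ (n k : ℕ) : ℕ := k.choose 2 + k * (n - k) + (n - k) / 2 * ((n - k + 1) / 2)

/-- The number of edges of `E₂(n,k)`, meaningful for `4 * k + 2 ≤ n`. -/
def num₂ (n k : ℕ) : ℕ := (2 * k + 1).choose 2 + n / 2 * ((n + 1) / 2)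

/-- The number of edges of `E₃(n,k)`, meaningful for `2 * k + 1 ≤ n`. -/
def num₃ (n k : ℕ) : ℕ := (2 * k + 1).choose 2 + (2 * k + 1) * (n - (2 * k + 1))

/-- The number of edges of `E₄(n,k)` if this is not the complete graph, meaningful for
`3 * k + 2 ≤ n ≤ 6 * k + 4`. It does not depend on the distribution of the vertices among
`Y₁` and `Y₂`. -/
def num₄ (n k : ℕ) : ℕ := (3 * k + 2).choose 2 + (n - (3 * k + 1)).choose 2

/-- The maximum number of edges of the extremal graphs. The value `0` stands for a class that is
not defined. -/
def maxNum (n k : ℕ) : ℕ :=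
  if n ≤ 3 * k + 2 then n.choose 2
  else max (max (num₁ n k) (num₃ n k))
    (max (if 4 * k + 2 ≤ n then num₂ n k else 0) (if n ≤ 6 * k + 4 then num₄ n k else 0))

section MaxNum

variable {n k m : ℕ}

lemma maxNum_of_le (h : n ≤ 3 * k + 2) : maxNum n k = n.choose 2 := if_pos h

lemma num₁_le_maxNum (h : 3 * k + 2 < n) : num₁ n k ≤ maxNum n k := by
  rw [maxNum, if_neg h.not_ge]
  omega

lemma num₂_le_maxNum (h : 3 * k + 2 < n) (h' : 4 * k + 2 ≤ n) : num₂ n k ≤ maxNum n k := by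
  rw [maxNum, if_neg h.not_ge, if_pos h']
  omega

lemma num₃_le_maxNum (h : 3 * k + 2 < n) : num₃ n k ≤ maxNum n k := by
  rw [maxNum, if_neg h.not_ge]
  omega

lemma num₄_le_maxNum (h : 3 * k + 2 < n) (h' : n ≤ 6 * k + 4) : num₄ n k ≤ maxNum n k := by
  rw [maxNum, if_neg h.not_ge, if_pos h']
  omega

lemma maxNum_eq_or (h : 3 * k + 2 < n) :
    maxNum n k = num₁ n k ∨ (4 * k + 2 ≤ n ∧ maxNum n k = num₂ n k) ∨
      maxNum n k = num₃ n k ∨ (n ≤ 6 * k + 4 ∧ maxNum n k = num₄ n k) := by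
  rw [maxNum, if_neg h.not_ge]
  split_ifs <;> omega

lemma maxNum_le (h : 3 * k + 2 < n) (h₁ : num₁ n k ≤ m) (h₂ : 4 * k + 2 ≤ n → num₂ n k ≤ m)
    (h₃ : num₃ n k ≤ m) (h₄ : n ≤ 6 * k + 4 → num₄ n k ≤ m) : maxNum n k ≤ m := by
  rw [maxNum, if_neg h.not_ge]
  split_ifs <;> omega

end MaxNum

section Increments

variable {n k : ℕ}

lemma half_mul_half_succ (n : ℕ) :
    (n + 1) / 2 * ((n + 1 + 1) / 2) = n / 2 * ((n + 1) / 2) + (n + 1) / 2 := by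
  rw [show (n + 1 + 1) / 2 = n / 2 + 1 by omega]
  ring

lemma choose_two_succ (n : ℕ) : (n + 1).choose 2 = n.choose 2 + n := by
  rw [Nat.choose_succ_succ', Nat.choose_one_right, add_comm]

lemma num₁_succ (h : k ≤ n) : num₁ (n + 1) k = num₁ n k + (k + (n - k + 1) / 2) := by
  rw [num₁, num₁, Nat.sub_add_comm h, half_mul_half_succ]
  ring

lemma num₂_succ (n k : ℕ) : num₂ (n + 1) k = num₂ n k + (n + 1) / 2 := by
  rw [num₂, num₂, half_mul_half_succ, add_assoc]

lemma num₃_succ (h : 2 * k + 1 ≤ n) : num₃ (n + 1) k = num₃ n k + (2 * k + 1) := by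
  rw [num₃, num₃, Nat.sub_add_comm h]
  ring

lemma num₄_succ (h : 3 * k + 1 ≤ n) : num₄ (n + 1) k = num₄ n k + (n - (3 * k + 1)) := by
  rw [num₄, num₄, Nat.sub_add_comm h, choose_two_succ (n - _), add_assoc]

lemma num₁_add_three (h : k ≤ n) : num₁ (n + 3) (k + 1) = num₁ n k + (2 * n + k + 3) := by
  obtain ⟨m, rfl⟩ := Nat.exists_eq_add_of_le h
  rw [num₁, num₁, show k + m + 3 - (k + 1) = m + 1 + 1 by omega, Nat.add_sub_cancel_left,
    half_mul_half_succ, half_mul_half_succ, choose_two_succ]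
  have : (m + 1) / 2 + (m + 1 + 1) / 2 = m + 1 := by omega
  linear_combination this

lemma num₂_add_three (n k : ℕ) :
    num₂ (n + 3) (k + 1) = num₂ n k + (n + 4 * k + 4 + (n + 3) / 2) := by
  rw [num₂, num₂, show 2 * (k + 1) + 1 = 2 * k + 1 + 1 + 1 by ring, choose_two_succ,
    choose_two_succ, half_mul_half_succ, half_mul_half_succ, half_mul_half_succ]
  omega

lemma num₃_add_three (h : 2 * k + 1 ≤ n) :
    num₃ (n + 3) (k + 1) = num₃ n k + (2 * n + 2 * k + 4) := by
  obtain ⟨m, rfl⟩ := Nat.exists_eq_add_of_le h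
  rw [num₃, num₃, show 2 * k + 1 + m + 3 - (2 * (k + 1) + 1) = m + 1 by omega,
    Nat.add_sub_cancel_left, show 2 * (k + 1) + 1 = 2 * k + 1 + 1 + 1 by ring, choose_two_succ,
    choose_two_succ]
  ring

lemma num₄_add_three (n k : ℕ) : num₄ (n + 3) (k + 1) = num₄ n k + 9 * (k + 1) := by
  rw [num₄, num₄, show n + 3 - (3 * (k + 1) + 1) = n - (3 * k + 1) by omega,
    show 3 * (k + 1) + 2 = 3 * k + 2 + 1 + 1 + 1 by ring, choose_two_succ, choose_two_succ,
    choose_two_succ]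
  ring

end Increments

section Comparisons

variable {n k : ℕ}

lemma two_mul_choose_two (n : ℕ) : (2 : ℤ) * (n.choose 2 : ℕ) = n * (n - 1) := by
  induction n with
  | zero => simp
  | succ n ih =>
    rw [choose_two_succ]
    push_cast
    linarith

lemma four_mul_half_mul_half (n : ℕ) :
    (4 : ℤ) * (n / 2 * ((n + 1) / 2) : ℕ) = n ^ 2 - n % 2 := by
  rcases Nat.even_or_odd' n with ⟨a, rfl | rfl⟩
  · rw [show 2 * a / 2 = a by omega, show (2 * a + 1) / 2 = a by omega,
      show ((2 * a : ℕ) : ℤ) % 2 = 0 by omega]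
    push_cast
    ring
  · rw [show (2 * a + 1) / 2 = a by omega, show (2 * a + 1 + 1) / 2 = a + 1 by omega,
      show ((2 * a + 1 : ℕ) : ℤ) % 2 = 1 by omega]
    push_cast
    ring

lemma four_mul_num₁ (h : k ≤ n) : (4 : ℤ) * num₁ n k =
    2 * (k * (k - 1)) + 4 * (k * (n - k)) + (n - k) ^ 2 - (n - k) % 2 := by
  have hhalf := four_mul_half_mul_half (n - k)
  have hchoose := two_mul_choose_two k
  rw [num₁]
  push_cast [h] at hhalf hchoose ⊢
  linarith

lemma four_mul_num₂ (n k : ℕ) : (4 : ℤ) * num₂ n k =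
    2 * ((2 * k + 1) * (2 * k)) + n ^ 2 - n % 2 := by
  have hhalf := four_mul_half_mul_half n
  have hchoose := two_mul_choose_two (2 * k + 1)
  rw [num₂]
  push_cast at hhalf hchoose ⊢
  linarith

lemma two_mul_num₃ (h : 2 * k + 1 ≤ n) : (2 : ℤ) * num₃ n k =
    (2 * k + 1) * (2 * k) + 2 * ((2 * k + 1) * (n - 2 * k - 1)) := by
  have hchoose := two_mul_choose_two (2 * k + 1)
  rw [num₃]
  push_cast [h] at hchoose ⊢
  linarith

lemma two_mul_num₄ (h : 3 * k + 1 ≤ n) : (2 : ℤ) * num₄ n k =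
    (3 * k + 2) * (3 * k + 1) + (n - 3 * k - 1) * (n - 3 * k - 2) := by
  have hchoose := two_mul_choose_two (3 * k + 2)
  have hchoose' := two_mul_choose_two (n - (3 * k + 1))
  rw [num₄]
  push_cast [h] at hchoose hchoose' ⊢
  linarith

lemma num₂_le_num₁ (h : 6 * k + 6 ≤ n) : num₂ n k ≤ num₁ n k := by
  have h₁ := four_mul_num₁ (n := n) (k := k) (by omega)
  have h₂ := four_mul_num₂ n k
  have hmod : ((n - k : ℤ) % 2) ≤ n % 2 + k := by omega
  zify at h ⊢
  suffices (4 : ℤ) * num₂ n k < 4 * num₁ n k + 4 by omega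
  nlinarith [mul_nonneg (Int.natCast_nonneg k) (sub_nonneg.2 h)]

lemma num₃_le_num₂ (h : 4 * k + 2 ≤ n) : num₃ n k ≤ num₂ n k := by
  have h₂ := four_mul_num₂ n k
  have h₃ := two_mul_num₃ (n := n) (k := k) (by omega)
  have hmod : (n : ℤ) % 2 ≤ 1 := by omega
  zify
  suffices (4 : ℤ) * num₃ n k < 4 * num₂ n k + 4 by omega
  nlinarith [sq_nonneg ((n : ℤ) - 4 * k - 2)]

lemma num₂_le_num₃_add_four (h : 4 * k + 2 ≤ n) (h' : n ≤ 4 * k + 6) :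
    num₂ n k ≤ num₃ n k + 4 := by
  have h₂ := four_mul_num₂ n k
  have h₃ := two_mul_num₃ (n := n) (k := k) (by omega)
  have hmod : (0 : ℤ) ≤ n % 2 := by omega
  zify at h h' ⊢
  nlinarith [mul_nonneg (sub_nonneg.2 h) (sub_nonneg.2 h')]

lemma num₂_le_num₃ (h : 4 * k + 2 ≤ n) (h' : n ≤ 4 * k + 3) : num₂ n k ≤ num₃ n k := by
  have h₂ := four_mul_num₂ n k
  have h₃ := two_mul_num₃ (n := n) (k := k) (by omega)
  have hmod : (0 : ℤ) ≤ n % 2 := by omega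
  zify at h h' ⊢
  suffices (4 : ℤ) * num₂ n k < 4 * num₃ n k + 4 by omega
  nlinarith [mul_nonneg (sub_nonneg.2 h) (sub_nonneg.2 h')]

lemma num₄_le_num₂ (h : 4 * k + 2 ≤ n) (h' : n ≤ 6 * k + 4) : num₄ n k ≤ num₂ n k := by
  have h₂ := four_mul_num₂ n k
  have h₄ := two_mul_num₄ (n := n) (k := k) (by omega)
  have hmod : (n : ℤ) % 2 ≤ 1 := by omega
  have hk : (0 : ℤ) ≤ k := by positivity
  zify at h h' ⊢
  suffices (4 : ℤ) * num₄ n k < 4 * num₂ n k + 4 by omega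
  nlinarith [mul_nonneg (sub_nonneg.2 h) (sub_nonneg.2 h'), mul_nonneg hk hk,
    mul_nonneg hk (sub_nonneg.2 h)]

lemma num₁_le_num₃ (h : 3 * k + 3 ≤ n) (h' : n ≤ 4 * k + 3) : num₁ n k ≤ num₃ n k := by
  have h₁ := four_mul_num₁ (n := n) (k := k) (by omega)
  have h₃ := two_mul_num₃ (n := n) (k := k) (by omega)
  have hmod : 0 ≤ (n - k : ℤ) % 2 := by omega
  have hk : (0 : ℤ) ≤ k := by positivity
  zify at h h' ⊢
  suffices (4 : ℤ) * num₁ n k < 4 * num₃ n k + 4 by omega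
  nlinarith [mul_nonneg (sub_nonneg.2 h) (sub_nonneg.2 h'), mul_nonneg hk (sub_nonneg.2 h),
    mul_nonneg hk (sub_nonneg.2 h')]

lemma num₄_le_num₃ (h : 7 * k + 6 ≤ 2 * n) (h' : n ≤ 4 * k + 3) : num₄ n k ≤ num₃ n k := by
  have h₃ := two_mul_num₃ (n := n) (k := k) (by omega)
  have h₄ := two_mul_num₄ (n := n) (k := k) (by omega)
  have hk : (0 : ℤ) ≤ k := by positivity
  zify at h h' ⊢
  nlinarith [mul_nonneg (sub_nonneg.2 h) (sub_nonneg.2 h'), mul_nonneg hk (sub_nonneg.2 h),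
    mul_nonneg hk (sub_nonneg.2 h')]

lemma num₁_le_num₁_succ (h : k + 2 ≤ n) : num₁ n k ≤ num₁ n (k + 1) := by
  have hk := four_mul_num₁ (n := n) (k := k) (by omega)
  have hk' := four_mul_num₁ (n := n) (k := k + 1) (by omega)
  have hmod : (n - (k + 1) : ℤ) % 2 ≤ (n - k) % 2 + 1 := by omega
  push_cast at hk'
  zify at h ⊢
  suffices (4 : ℤ) * num₁ n k < 4 * num₁ n (k + 1) + 4 by omega
  nlinarith

lemma num₂_le_num₂_succ (n k : ℕ) : num₂ n k ≤ num₂ n (k + 1) :=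
  Nat.add_le_add_right (Nat.choose_mono 2 (by omega)) _

lemma num₃_add_four_le_num₃_succ (h : 2 * k + 5 ≤ n) : num₃ n k + 4 ≤ num₃ n (k + 1) := by
  have hk := two_mul_num₃ (n := n) (k := k) (by omega)
  have hk' := two_mul_num₃ (n := n) (k := k + 1) (by omega)
  push_cast at hk'
  zify at h ⊢
  nlinarith

lemma num₄_le_num₄_succ (h : 3 * k + 4 ≤ n) (h' : n ≤ 6 * k + 6) :
    num₄ n k ≤ num₄ n (k + 1) := by
  have hk := two_mul_num₄ (n := n) (k := k) (by omega)
  have hk' := two_mul_num₄ (n := n) (k := k + 1) (by omega)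
  push_cast at hk'
  zify at h h' ⊢
  nlinarith

end Comparisons

section MaxNumIncrements

variable {n k : ℕ}

lemma maxNum_le_max_num₁_num₂ (h : 4 * k + 2 ≤ n) : maxNum n k ≤ max (num₁ n k) (num₂ n k) := by
  rcases Nat.lt_or_ge (3 * k + 2) n with hn | hn
  · exact maxNum_le hn (le_max_left _ _) (fun _ => le_max_right _ _)
      ((num₃_le_num₂ h).trans (le_max_right _ _))
      fun h' => (num₄_le_num₂ h h').trans (le_max_right _ _)
  · obtain ⟨rfl, rfl⟩ : k = 0 ∧ n = 2 := by omega
    decide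

lemma maxNum_add_half_le_maxNum_succ (h : 4 * k + 2 ≤ n) :
    maxNum n k + (n + 1) / 2 ≤ maxNum (n + 1) k := by
  have hmax := maxNum_le_max_num₁_num₂ h
  have h₁ := num₁_le_maxNum (n := n + 1) (k := k) (by omega)
  have h₂ := num₂_le_maxNum (n := n + 1) (k := k) (by omega) (by omega)
  rw [num₁_succ (by omega)] at h₁
  rw [num₂_succ] at h₂
  omega

lemma maxNum_add_le_maxNum_succ (h : 3 * k + 2 ≤ n) (h' : n ≤ 4 * k + 1) :
    maxNum n k + (n - (3 * k + 1)) ≤ maxNum (n + 1) k := by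
  have h₁ := num₁_le_maxNum (n := n + 1) (k := k) (by omega)
  have h₃ := num₃_le_maxNum (n := n + 1) (k := k) (by omega)
  have h₄ := num₄_le_maxNum (n := n + 1) (k := k) (by omega) (by omega)
  rw [num₁_succ (by omega)] at h₁
  rw [num₃_succ (by omega)] at h₃
  rw [num₄_succ (by omega)] at h₄
  rcases h.eq_or_lt with rfl | hlt
  · rw [maxNum_of_le le_rfl]
    refine le_trans (le_of_eq ?_) h₄
    simp [num₄]
  · have := maxNum_eq_or hlt
    omega

lemma maxNum_add_le_maxNum_add_three_of_sparse (h : 4 * k + 4 ≤ n) :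
    maxNum n k + (2 * n + k + 3) ≤ maxNum (n + 3) (k + 1) := by
  have hmax := maxNum_le_max_num₁_num₂ (n := n) (k := k) (by omega)
  have h₁ := num₁_le_maxNum (n := n + 3) (k := k + 1) (by omega)
  have h₂ := num₂_le_maxNum (n := n + 3) (k := k + 1) (by omega) (by omega)
  have h₂₁ := num₂_le_num₁ (n := n) (k := k)
  rw [num₁_add_three (by omega)] at h₁
  rw [num₂_add_three] at h₂
  omega

lemma maxNum_add_le_maxNum_add_three_of_dense (h : 3 * k + 3 ≤ n) (h' : n ≤ 4 * k + 3) :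
    maxNum n k + (2 * n + 2 * k + 4) ≤ maxNum (n + 3) (k + 1) := by
  have h₃ := num₃_le_maxNum (n := n + 3) (k := k + 1) (by omega)
  have h₄ := num₄_le_maxNum (n := n + 3) (k := k + 1) (by omega) (by omega)
  rw [num₃_add_three (by omega)] at h₃
  rw [num₄_add_three] at h₄
  have h₁₃ := num₁_le_num₃ h h'
  have h₂₃ := fun hn : 4 * k + 2 ≤ n => num₂_le_num₃ hn h'
  have h₄₃ := fun hn : 7 * k + 6 ≤ 2 * n => num₄_le_num₃ hn h'
  have := maxNum_eq_or h
  omega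

lemma maxNum_le_maxNum_succ (h : 3 * k + 6 ≤ n) : maxNum n k ≤ maxNum n (k + 1) := by
  have h₃ : num₃ n k + 4 ≤ maxNum n (k + 1) :=
    (num₃_add_four_le_num₃_succ (by omega)).trans (num₃_le_maxNum (by omega))
  refine maxNum_le (by omega) ((num₁_le_num₁_succ (by omega)).trans (num₁_le_maxNum (by omega)))
    (fun h₂ => ?_) (by omega) fun h₄ =>
      (num₄_le_num₄_succ (by omega) (by omega)).trans (num₄_le_maxNum (by omega) (by omega))
  rcases Nat.lt_or_ge n (4 * k + 6) with hn | hn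
  · exact (num₂_le_num₃_add_four h₂ hn.le).trans h₃
  · exact (num₂_le_num₂_succ n k).trans (num₂_le_maxNum (by omega) (by omega))

end MaxNumIncrements

section VertexDeletion

variable {V : Type*} [Fintype V] {G : SimpleGraph V} {u v w : V}

lemma numEdges_le_choose_two (G : SimpleGraph V) : numEdges G ≤ (Fintype.card V).choose 2 := by
  classical
  rw [numEdges, ← SimpleGraph.coe_edgeFinset, Set.ncard_coe_finset]
  exact G.card_edgeFinset_le_card_choose_two

variable [DecidableEq V]

lemma numEdges_eq_numEdges_induce_erase_add_degIn (G : SimpleGraph V) (v : V) :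
    numEdges G = numEdges (G.induce (univ.erase v : Finset V)) + degIn G univ v := by
  have h := degSum_erase (G := G) (mem_univ v)
  rw [degSum_univ, ← two_mul_numEdges_induce] at h
  omega

lemma numEdges_add_three_eq_numEdges_induce_erase_add_degIn (huv : G.Adj u v) (huw : G.Adj u w)
    (hvw : G.Adj v w) :
    numEdges G + 3 = numEdges (G.induce (((univ.erase u).erase v).erase w : Finset V)) +
      (degIn G univ u + degIn G univ v + degIn G univ w) := by
  have hv : v ∈ univ.erase u := mem_erase.2 ⟨huv.ne', mem_univ v⟩
  have hw : w ∈ (univ.erase u).erase v := mem_erase.2 ⟨hvw.ne', mem_erase.2 ⟨huw.ne', mem_univ w⟩⟩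
  have hG := degSum_add_two_of_adj (mem_univ u) (mem_univ v) huv
  have hGw := degSum_erase (G := G) hw
  rw [degSum_univ] at hG
  rw [← two_mul_numEdges_induce (((univ.erase u).erase v).erase w)] at hGw
  have hdu := degIn_erase_add_one (mem_univ u) huw.symm
  have hdv := degIn_erase_add_one hv hvw.symm
  omega

end VertexDeletion

universe u

/-- Every graph on `n` vertices without `l` disjoint triangles has at most `m` edges. -/
def EdgeBound (n l m : ℕ) : Prop :=
  ∀ (V : Type u) [Fintype V] (G : SimpleGraph V), Fintype.card V = n →
    ¬ HasDisjointTriangles G l → numEdges G ≤ m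

namespace EdgeBound

section Deletion

variable {V : Type u} [Fintype V] {G : SimpleGraph V} {u v w : V} {n l m : ℕ}

lemma numEdges_le_add_degIn (h : EdgeBound.{u} n l m) (hV : Fintype.card V = n + 1)
    (hno : ¬ HasDisjointTriangles G l) (v : V) : numEdges G ≤ m + degIn G univ v := by
  classical
  have hcard : Fintype.card (univ.erase v : Finset V) = n := by
    rw [Fintype.card_coe, card_erase_of_mem (mem_univ v), card_univ, hV, Nat.add_sub_cancel]
  rw [numEdges_eq_numEdges_induce_erase_add_degIn G v]
  exact Nat.add_le_add_right
    (h _ _ hcard fun hG => hno (hasDisjointTriangles_of_induce hG)) _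

lemma numEdges_add_three_le_add_degIn (h : EdgeBound.{u} n l m) (hV : Fintype.card V = n + 3)
    (hno : ¬ HasDisjointTriangles G (l + 1)) (huv : G.Adj u v) (huw : G.Adj u w)
    (hvw : G.Adj v w) :
    numEdges G + 3 ≤ m + (degIn G univ u + degIn G univ v + degIn G univ w) := by
  classical
  have hcard : Fintype.card (((univ.erase u).erase v).erase w : Finset V) = n := by
    rw [Fintype.card_coe, card_erase_of_mem, card_erase_of_mem, card_erase_of_mem, card_univ, hV]
    · rfl
    all_goals simp [huv.ne', huw.ne', hvw.ne']
  have hdisj : Disjoint (({u, v, w} : Finset V) : Set V)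
      (((univ.erase u).erase v).erase w : Finset V) := by
    rw [disjoint_coe, disjoint_right]
    simp +contextual
  rw [numEdges_add_three_eq_numEdges_induce_erase_add_degIn huv huw hvw]
  exact Nat.add_le_add_right (h _ _ hcard fun hG => hno
    (hasDisjointTriangles_succ_of_induce (isNClique_triple huv huw hvw) hdisj hG)) _

end Deletion

variable {n k : ℕ}

lemma maxNum_of_le (h : n ≤ 3 * k + 2) : EdgeBound.{u} n (k + 1) (maxNum n k) := by
  rintro V _ G rfl -
  rw [DensityCH.maxNum_of_le h]
  exact numEdges_le_choose_two G

lemma maxNum_zero (h : EdgeBound.{u} (n + 2) 1 (maxNum (n + 2) 0)) :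
    EdgeBound.{u} (n + 3) 1 (maxNum (n + 3) 0) := by
  intro V _ G hV hno
  classical
  by_contra! hlt
  have hmax : maxNum (n + 2) 0 + (n + 3) / 2 ≤ maxNum (n + 3) 0 :=
    maxNum_add_half_le_maxNum_succ (by omega)
  refine hno (hasDisjointTriangles_succ_of_sparse (by omega) (fun v => ?_)
    (fun u v w huv huw hvw => ?_) IsTiling.empty.hasDisjointTriangles)
  · have := h.numEdges_le_add_degIn hV hno v
    omega
  · exact absurd (IsTiling.singleton (isNClique_triple huv huw hvw)).hasDisjointTriangles hno

lemma maxNum_succ_of_sparse (hn : 4 * k + 4 ≤ n)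
    (hk : EdgeBound.{u} (n + 3) (k + 1) (maxNum (n + 3) k))
    (hvertex : EdgeBound.{u} (n + 2) (k + 2) (maxNum (n + 2) (k + 1)))
    (htriangle : EdgeBound.{u} n (k + 1) (maxNum n k)) :
    EdgeBound.{u} (n + 3) (k + 2) (maxNum (n + 3) (k + 1)) := by
  intro V _ G hV hno
  by_contra! hlt
  have hmax₁ : maxNum (n + 2) (k + 1) + (n + 3) / 2 ≤ maxNum (n + 3) (k + 1) :=
    maxNum_add_half_le_maxNum_succ (by omega)
  have hmax₃ := maxNum_add_le_maxNum_add_three_of_sparse hn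
  have hmono := maxNum_le_maxNum_succ (n := n + 3) (k := k) (by omega)
  refine hno (hasDisjointTriangles_succ_of_sparse (by omega) (fun v => ?_)
    (fun u v w huv huw hvw => ?_) (of_not_not fun hG => ?_))
  · have := hvertex.numEdges_le_add_degIn hV hno v
    omega
  · have := htriangle.numEdges_add_three_le_add_degIn hV hno huv huw hvw
    omega
  · exact hlt.not_ge ((hk V G hV hG).trans hmono)

lemma maxNum_succ_of_dense (hn : 3 * k + 3 ≤ n) (hn' : n ≤ 4 * k + 3)
    (hvertex : EdgeBound.{u} (n + 2) (k + 2) (maxNum (n + 2) (k + 1)))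
    (htriangle : EdgeBound.{u} n (k + 1) (maxNum n k)) :
    EdgeBound.{u} (n + 3) (k + 2) (maxNum (n + 3) (k + 1)) := by
  intro V _ G hV hno
  by_contra! hlt
  obtain ⟨μ, rfl⟩ := Nat.exists_eq_add_of_le (show 3 * k + 2 ≤ n by omega)
  set n := 3 * k + 2 + μ
  have hmax₁ : maxNum (n + 2) (k + 1) + (n + 2 - (3 * (k + 1) + 1)) ≤ maxNum (n + 3) (k + 1) :=
    maxNum_add_le_maxNum_succ (by omega) (by omega)
  have hmax₃ := maxNum_add_le_maxNum_add_three_of_dense hn hn'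
  have hdeg : ∀ v, μ < degIn G univ v := fun v => by
    have := hvertex.numEdges_le_add_degIn hV hno v
    omega
  have htri : ∀ u v w, G.Adj u v → G.Adj u w → G.Adj v w →
      2 * Fintype.card V + 2 * (k + 1) ≤ degIn G univ u + degIn G univ v + degIn G univ w :=
    fun u v w huv huw hvw => by
      have := htriangle.numEdges_add_three_le_add_degIn hV hno huv huw hvw
      omega
  have hnum₃ := two_mul_num₃ (n := n + 3) (k := k + 1) (by omega)
  have hnum₄ := two_mul_num₄ (n := n + 3) (k := k + 1) (by omega)
  have hle₃ := num₃_le_maxNum (n := n + 3) (k := k + 1) (by omega)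
  have hle₄ := num₄_le_maxNum (n := n + 3) (k := k + 1) (by omega) (by omega)
  rcases hasDisjointTriangles_or_degSum_le (by omega) (by omega) hdeg htri with h | h | h
  · exact hno h
  all_goals
    rw [degSum_univ] at h
    push_cast [n] at hnum₃ hnum₄
    zify at h hle₃ hle₄ hlt
    linarith

end EdgeBound

theorem edgeBound_maxNum (n k : ℕ) : EdgeBound.{u} n (k + 1) (maxNum n k) := by
  induction n using Nat.strong_induction_on generalizing k with
  | _ n ih =>
  induction k with
  | zero =>
    rcases Nat.lt_or_ge n 3 with hn | hn
    · exact EdgeBound.maxNum_of_le (by omega)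
    obtain ⟨n, rfl⟩ := Nat.exists_eq_add_of_le' hn
    exact EdgeBound.maxNum_zero (ih _ (by omega) _)
  | succ k ihk =>
    rcases Nat.lt_or_ge n (3 * k + 6) with hn | hn
    · exact EdgeBound.maxNum_of_le (by omega)
    obtain ⟨n, rfl⟩ := Nat.exists_eq_add_of_le' (show 3 ≤ n by omega)
    have hvertex := ih (n + 2) (by omega) (k + 1)
    have htriangle := ih n (by omega) k
    rcases Nat.lt_or_ge n (4 * k + 4) with hn' | hn'
    · exact EdgeBound.maxNum_succ_of_dense (by omega) (by omega) hvertex htriangle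
    · exact EdgeBound.maxNum_succ_of_sparse hn' ihk hvertex htriangle

section DegreeCounting

variable {V : Type*} [Fintype V] {G : SimpleGraph V} {A D : Finset V}

lemma sum_degIn_univ_of_adj_iff (h : ∀ v ∈ A, ∀ w, G.Adj v w ↔ w ∈ D) :
    ∑ v ∈ A, degIn G univ v = #A * #D := by
  classical
  refine sum_const_nat fun v hv => ?_
  rw [degIn]
  congr 1
  ext w
  simp [h v hv]

lemma sum_degIn_univ_add_card_of_eq_or_adj_iff (h : ∀ v ∈ A, ∀ w, v = w ∨ G.Adj v w ↔ w ∈ D) :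
    ∑ v ∈ A, degIn G univ v + #A = #A * #D := by
  classical
  rw [card_eq_sum_ones A, ← sum_add_distrib, ← card_eq_sum_ones]
  refine sum_const_nat fun v hv => ?_
  have hinsert : D = insert v ({w | G.Adj v w} : Finset V) := by
    ext w
    simp [← h v hv, eq_comm]
  rw [hinsert, card_insert_of_notMem (by simp), degIn]

end DegreeCounting

section ExtremalGraphs

variable {n k : ℕ} {H : SimpleGraph (Fin n)}

lemma Partitions.sum_eq {L : List (Finset (Fin n))} (hL : Partitions L) (f : Fin n → ℕ) :
    ∑ v, f v = (L.map fun A => ∑ v ∈ A, f v).sum := by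
  have hcover : univ.biUnion (fun i : Fin L.length => L[i]) = univ := by
    ext v
    simpa [List.mem_iff_get] using hL.2 v
  have hdisj : Pairwise fun i j : Fin L.length => Disjoint L[i] L[j] := by
    intro i j hij
    rcases hij.lt_or_gt with h | h
    · exact List.pairwise_iff_getElem.1 hL.1 _ _ _ _ h
    · exact (List.pairwise_iff_getElem.1 hL.1 _ _ _ _ h).symm
  rw [← hcover, sum_biUnion fun i _ j _ hij => hdisj hij]
  exact Fin.sum_univ_fun_getElem L fun A => ∑ v ∈ A, f v

lemma Partitions.two_mul_numEdges {L : List (Finset (Fin n))} (hL : Partitions L)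
    (H : SimpleGraph (Fin n)) :
    2 * numEdges H = (L.map fun A => ∑ v ∈ A, degIn H univ v).sum := by
  rw [← degSum_univ, degSum, hL.sum_eq]

lemma partitions_pair_iff {X Y : Finset (Fin n)} :
    Partitions [X, Y] ↔ Disjoint X Y ∧ ∀ v, v ∈ X ∨ v ∈ Y := by
  simp [Partitions]

lemma partitions_triple_iff {X Y Z : Finset (Fin n)} : Partitions [X, Y, Z] ↔
    Disjoint X Y ∧ Disjoint X Z ∧ Disjoint Y Z ∧ ∀ v, v ∈ X ∨ v ∈ Y ∨ v ∈ Z := by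
  simp [Partitions, and_assoc]

lemma exists_partitions_triple {a b c : ℕ} (h : a + b + c = n) : ∃ X Y Z : Finset (Fin n),
    Partitions [X, Y, Z] ∧ #X = a ∧ #Y = b ∧ #Z = c := by
  obtain ⟨W, -, hW⟩ := exists_subset_card_eq
    (show a + b ≤ #(univ : Finset (Fin n)) by rw [card_fin]; omega)
  obtain ⟨X, hXW, hX⟩ := exists_subset_card_eq (show a ≤ #W by omega)
  refine ⟨X, W \ X, Wᶜ, partitions_triple_iff.2 ⟨disjoint_sdiff,
    disjoint_compl_right.mono_left hXW, disjoint_compl_right.mono_left sdiff_subset, fun v => ?_⟩,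
    hX, ?_, ?_⟩
  · simp only [mem_sdiff, mem_compl]
    tauto
  · rw [card_sdiff_of_subset hXW]
    omega
  · rw [card_compl, Fintype.card_fin]
    omega

lemma IsE₁.numEdges_eq (hk : k ≤ n) (h : IsE₁ n k H) : numEdges H = num₁ n k := by
  obtain ⟨X, Y₁, Y₂, hP, hX, hY₁, hY₂, hadj⟩ := h
  have hsum := hP.two_mul_numEdges H
  obtain ⟨d₁, d₂, d₁₂, -⟩ := partitions_triple_iff.1 hP
  have hdegX := sum_degIn_univ_add_card_of_eq_or_adj_iff (G := H) (A := X) (D := univ) (by grind)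
  have hdegY₁ := sum_degIn_univ_of_adj_iff (G := H) (A := Y₁) (D := X ∪ Y₂)
    (by grind [Between, disjoint_left])
  have hdegY₂ := sum_degIn_univ_of_adj_iff (G := H) (A := Y₂) (D := X ∪ Y₁)
    (by grind [Between, disjoint_left])
  rw [card_fin, hX] at hdegX
  rw [card_union_of_disjoint d₂, hX, hY₁, hY₂] at hdegY₁
  rw [card_union_of_disjoint d₁, hX, hY₁, hY₂] at hdegY₂
  obtain ⟨m, rfl⟩ := Nat.exists_eq_add_of_le hk
  have hchoose := two_mul_choose_two k
  have hm : (m + 1) / 2 + m / 2 = m := by omega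
  simp only [List.map_cons, List.map_nil, List.sum_cons, List.sum_nil] at hsum
  rw [num₁]
  rw [Nat.add_sub_cancel_left] at hdegY₁ hdegY₂ ⊢
  zify at hsum hdegX hdegY₁ hdegY₂ hm ⊢
  refine mul_left_cancel₀ (two_ne_zero (α := ℤ)) ?_
  linear_combination hsum + hdegX + hdegY₁ + hdegY₂ - hchoose + (k : ℤ) * hm

lemma IsE₂.numEdges_eq (h : IsE₂ n k H) : numEdges H = num₂ n k := by
  obtain ⟨-, X, Y₁, Y₂, hP, hX, hY, hadj⟩ := h
  have hsum := hP.two_mul_numEdges H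
  obtain ⟨d₁, d₂, d₁₂, -⟩ := partitions_triple_iff.1 hP
  have hdegX := sum_degIn_univ_add_card_of_eq_or_adj_iff (G := H) (A := X) (D := X ∪ Y₁)
    (by grind [Between, disjoint_left])
  have hdegY₁ := sum_degIn_univ_of_adj_iff (G := H) (A := Y₁) (D := X ∪ Y₂)
    (by grind [Between, disjoint_left])
  have hdegY₂ := sum_degIn_univ_of_adj_iff (G := H) (A := Y₂) (D := Y₁)
    (by grind [Between, disjoint_left])
  rw [card_union_of_disjoint d₁, hX] at hdegX
  rw [card_union_of_disjoint d₂, hX] at hdegY₁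
  have hchoose := two_mul_choose_two (2 * k + 1)
  have hprod : #Y₁ * (2 * k + 1 + #Y₂) = n / 2 * ((n + 1) / 2) := by
    rcases hY with ⟨hY₁, hY₂⟩ | ⟨hY₁, hY₂⟩
    · rw [hY₁, add_comm (2 * k + 1), hY₂]
    · rw [hY₁, add_comm (2 * k + 1), hY₂, mul_comm]
  simp only [List.map_cons, List.map_nil, List.sum_cons, List.sum_nil] at hsum
  rw [num₂, ← hprod]
  zify at hsum hdegX hdegY₁ hdegY₂ hchoose ⊢
  linarith

lemma IsE₃.numEdges_eq (h : IsE₃ n k H) : numEdges H = num₃ n k := by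
  obtain ⟨X, Y₁, hP, hX, hY₁, hadj⟩ := h
  have hsum := hP.two_mul_numEdges H
  obtain ⟨d₁, -⟩ := partitions_pair_iff.1 hP
  have hdegX := sum_degIn_univ_add_card_of_eq_or_adj_iff (G := H) (A := X) (D := univ) (by grind)
  have hdegY₁ := sum_degIn_univ_of_adj_iff (G := H) (A := Y₁) (D := X) (by grind [disjoint_left])
  have hchoose := two_mul_num₃ (n := n) (k := k) (by omega)
  simp only [List.map_cons, List.map_nil, List.sum_cons, List.sum_nil] at hsum
  rw [card_fin, hX] at hdegX
  rw [hX] at hdegY₁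
  zify at hsum hdegX hdegY₁ hY₁ ⊢
  refine mul_left_cancel₀ (two_ne_zero (α := ℤ)) ?_
  linear_combination hsum + hdegX + hdegY₁ - hchoose + (2 * k + 1 : ℤ) * hY₁

lemma IsE₄.numEdges_eq (hn : 3 * k + 2 < n) (h : IsE₄ n k H) :
    n ≤ 6 * k + 4 ∧ numEdges H = num₄ n k := by
  obtain ⟨-, ⟨hn', -⟩ | ⟨-, X, Y₁, Y₂, Y₃, Y₄, hP, h₁₃, h₂₄, h₁₂, hX, hadj⟩⟩ := h
  · omega
  refine ⟨by omega, ?_⟩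
  have hsum := hP.two_mul_numEdges H
  obtain ⟨⟨⟨dX₁, dX₂, dX₃, dX₄⟩, ⟨d₁₂, d₁₃, d₁₄⟩, ⟨d₂₃, d₂₄⟩, d₃₄⟩, -⟩ := by
    simpa [Partitions] using hP
  have hdegX := sum_degIn_univ_add_card_of_eq_or_adj_iff (G := H) (A := X) (D := X ∪ (Y₁ ∪ Y₂))
    (by grind [Between, disjoint_left])
  have hdegY₁ := sum_degIn_univ_of_adj_iff (G := H) (A := Y₁) (D := X ∪ (Y₂ ∪ Y₃))
    (by grind [Between, disjoint_left])
  have hdegY₂ := sum_degIn_univ_of_adj_iff (G := H) (A := Y₂) (D := X ∪ (Y₁ ∪ Y₄))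
    (by grind [Between, disjoint_left])
  have hdegY₃ := sum_degIn_univ_of_adj_iff (G := H) (A := Y₃) (D := Y₁ ∪ Y₄)
    (by grind [Between, disjoint_left])
  have hdegY₄ := sum_degIn_univ_of_adj_iff (G := H) (A := Y₄) (D := Y₂ ∪ Y₃)
    (by grind [Between, disjoint_left])
  rw [card_union_of_disjoint (by simp [*]), card_union_of_disjoint ‹_›] at hdegX hdegY₁ hdegY₂
  rw [card_union_of_disjoint ‹_›, ← h₁₃, ← h₂₄] at hdegY₃ hdegY₄
  rw [← h₁₃] at hdegY₁
  rw [← h₂₄] at hdegY₂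
  simp only [List.map_cons, List.map_nil, List.sum_cons, List.sum_nil] at hsum
  have htwo := two_mul_num₄ (n := n) (k := k) (by omega)
  zify at hsum hdegX hdegY₁ hdegY₂ hdegY₃ hdegY₄ h₁₂ hX ⊢
  have hX' : (#X : ℤ) = 6 * k + 4 - n := by linarith
  have hY₂' : (#Y₂ : ℤ) = n - 3 * k - 2 - #Y₁ := by linarith
  simp only [hX', hY₂'] at hdegX hdegY₁ hdegY₂ hdegY₃ hdegY₄
  linarith

lemma isExtremalEdgeNumber₁ (hk : k ≤ n) : IsExtremalEdgeNumber n k 0 (num₁ n k) := by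
  refine ⟨?_, fun H hH => IsE₁.numEdges_eq hk hH⟩
  obtain ⟨X, Y₁, Y₂, hP, hX, hY₁, hY₂⟩ := exists_partitions_triple
    (show k + (n - k + 1) / 2 + (n - k) / 2 = n by omega)
  refine ⟨SimpleGraph.fromRel fun u v => u ∈ X ∨ v ∈ X ∨ Between Y₁ Y₂ u v,
    X, Y₁, Y₂, hP, hX, hY₁, hY₂, fun u v => ?_⟩
  rw [SimpleGraph.fromRel_adj]
  unfold Between
  tauto

lemma isExtremalEdgeNumber₂ (hk : 4 * k + 2 ≤ n) : IsExtremalEdgeNumber n k 1 (num₂ n k) := by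
  refine ⟨?_, fun H hH => IsE₂.numEdges_eq hH⟩
  obtain ⟨X, Y₁, Y₂, hP, hX, hY₁, hY₂⟩ := exists_partitions_triple
    (show 2 * k + 1 + n / 2 + ((n + 1) / 2 - (2 * k + 1)) = n by omega)
  refine ⟨SimpleGraph.fromRel fun u v => (u ∈ X ∧ v ∈ X) ∨ Between Y₁ (X ∪ Y₂) u v,
    by omega, X, Y₁, Y₂, hP, hX, Or.inl ⟨hY₁, by omega⟩, fun u v => ?_⟩
  rw [SimpleGraph.fromRel_adj]
  unfold Between
  tauto

lemma isExtremalEdgeNumber₃ (hk : 2 * k + 1 ≤ n) : IsExtremalEdgeNumber n k 2 (num₃ n k) := by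
  refine ⟨?_, fun H hH => IsE₃.numEdges_eq hH⟩
  obtain ⟨X, -, hX⟩ := exists_subset_card_eq
    (show 2 * k + 1 ≤ #(univ : Finset (Fin n)) by rwa [card_fin])
  refine ⟨SimpleGraph.fromRel fun u v => u ∈ X ∨ v ∈ X, X, Xᶜ,
    partitions_pair_iff.2 ⟨disjoint_compl_right, fun v => by simp [em]⟩, hX, ?_, fun u v => ?_⟩
  · rw [card_compl, Fintype.card_fin, hX, Nat.sub_add_cancel hk]
  · rw [SimpleGraph.fromRel_adj]
    tauto

lemma isExtremalEdgeNumber₄ (hk : 3 * k + 2 < n) (hn : n ≤ 6 * k + 4) :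
    IsExtremalEdgeNumber n k 3 (num₄ n k) := by
  refine ⟨?_, fun H hH => (IsE₄.numEdges_eq hk hH).2⟩
  obtain ⟨X, Y₁, Y₃, hP, hX, hY₁, hY₃⟩ := exists_partitions_triple
    (show 6 * k + 4 - n + (n - (3 * k + 2)) + (n - (3 * k + 2)) = n by omega)
  refine ⟨SimpleGraph.fromRel fun u v => (u ∈ X ∧ v ∈ X) ∨ Between X Y₁ u v ∨ Between Y₁ Y₃ u v,
    by omega, Or.inr ⟨hk, X, Y₁, ∅, Y₃, ∅, ?_, by rw [hY₁, hY₃], rfl, ?_, by omega,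
      fun u v => ?_⟩⟩
  · simpa [Partitions, and_assoc] using partitions_triple_iff.1 hP
  · rw [hY₁, card_empty]
    omega
  · rw [SimpleGraph.fromRel_adj, union_empty, empty_union]
    grind [Between]

lemma isExtremalEdgeNumber_of_le (h : n ≤ 3 * k + 2) :
    IsExtremalEdgeNumber n k 3 (n.choose 2) := by
  refine ⟨⟨⊤, by omega, Or.inl ⟨h, rfl⟩⟩, ?_⟩
  rintro H ⟨-, ⟨-, rfl⟩ | ⟨hn, -⟩⟩
  · rw [numEdges, ← SimpleGraph.coe_edgeFinset, Set.ncard_coe_finset,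
      SimpleGraph.card_edgeFinset_top_eq_card_choose_two, Fintype.card_fin]
  · omega

lemma le_maxNum_of_isExtremalEdgeNumber {j : Fin 4} {m : ℕ} (h : IsExtremalEdgeNumber n k j m) :
    m ≤ maxNum n k := by
  obtain ⟨⟨H, hH⟩, hm⟩ := h
  rw [← hm H hH]
  rcases Nat.lt_or_ge (3 * k + 2) n with hn | hn
  · fin_cases j
    · rw [IsE₁.numEdges_eq (by omega) hH]
      exact num₁_le_maxNum hn
    · have hH₂ : IsE₂ n k H := hH
      rw [hH₂.numEdges_eq]
      exact num₂_le_maxNum hn hH₂.1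
    · rw [IsE₃.numEdges_eq hH]
      exact num₃_le_maxNum hn
    · obtain ⟨hn', hnum⟩ := IsE₄.numEdges_eq hn hH
      rw [hnum]
      exact num₄_le_maxNum hn hn'
  · rw [maxNum_of_le hn]
    simpa using numEdges_le_choose_two H

lemma exists_isExtremalEdgeNumber_maxNum (n k : ℕ) :
    ∃ j, IsExtremalEdgeNumber n k j (maxNum n k) := by
  rcases Nat.lt_or_ge (3 * k + 2) n with hn | hn
  · rcases maxNum_eq_or hn with h | ⟨hn', h⟩ | h | ⟨hn', h⟩ <;> rw [h]
    · exact ⟨0, isExtremalEdgeNumber₁ (by omega)⟩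
    · exact ⟨1, isExtremalEdgeNumber₂ hn'⟩
    · exact ⟨2, isExtremalEdgeNumber₃ (by omega)⟩
    · exact ⟨3, isExtremalEdgeNumber₄ hn hn'⟩
  · rw [maxNum_of_le hn]
    exact ⟨3, isExtremalEdgeNumber_of_le hn⟩

end ExtremalGraphs

end DensityCH

theorem mainTheorem1_general (n k : ℕ) : ∃ M : ℕ,
    IsGreatest {m : ℕ | ∃ j : Fin 4, DensityCH.IsExtremalEdgeNumber n k j m} M ∧
    ∀ (V : Type*) [Fintype V] (G : SimpleGraph V), Fintype.card V = n →
      ¬ DensityCH.HasDisjointTriangles G (k + 1) → DensityCH.numEdges G ≤ M :=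
  ⟨DensityCH.maxNum n k, ⟨DensityCH.exists_isExtremalEdgeNumber_maxNum n k,
    fun _ ⟨_, h⟩ => DensityCH.le_maxNum_of_isExtremalEdgeNumber h⟩, DensityCH.edgeBound_maxNum n k⟩

/-- The number `M` is the maximum of `e(E_j(n,k))` over those `j ∈ [4]` for which `E_j(n,k)` is
defined. -/
theorem mainTheorem1 :
    ∃ n₀ : ℕ, ∀ n : ℕ, n₀ < n → ∀ k : ℕ, (k : ℝ) ≤ (n : ℝ) / 3 →
      ∃ M : ℕ,
        IsGreatest {m : ℕ | ∃ j : Fin 4, DensityCH.IsExtremalEdgeNumber n k j m} M ∧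
        ∀ (V : Type*) [Fintype V] (G : SimpleGraph V), Fintype.card V = n →
          ¬ DensityCH.HasDisjointTriangles G (k + 1) →
          DensityCH.numEdges G ≤ M :=
  ⟨0, fun n _ k _ => mainTheorem1_general n k⟩
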